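/- Let $D\subset\mathbb R^d$, $d\ge 1$, be a bounded open set (for instance a bounded Lipschitz domain with $d\in\{1,2,3\}$), let $V=H^1_0(D)$ be the closure of $C_c^\infty(D)$ in $H^1(D)$, normed by $\|v\|_V=\|\nabla v\|_{L^2(D)}$, and let $f\in V^*$. Let $\psi_j\in L^\infty(D)$, $j\in\mathbb N$, be such that there is a sequence of positive numbers $(\lambda_j)$ with $\sum_j \exp(-\lambda_j^2)<\infty$ for which $\sum_j\lambda_j|\psi_j|$ converges in $L^\infty(D)$. Let $\gamma$ be the countable product on $U=\mathbb R^{\mathbb N}$ of the standard Gaussian measure on $\mathbb R$. For $y\in U$ put $b(y)=\sum_j y_j\psi_j$ (convergence a.e. in $D$), let $U_0$ be the set of those $y$ for which $b(y)$ exists and belongs to $L^\infty(D)$, and for $y\in U_0$ let $u(y)\in V$ be the weak solution of $-\operatorname{div}(\exp(b(y))\nabla u(y))=f$ in $D$, $u(y)=0$ on $\partial D$, that is $$\int_D \exp(b(y))\,\nabla u(y)\cdot\nabla v\,dx=\langle f,v\rangle\qquad\text{for all } v\in V .$$ Let $\mathcal F$ be the set of finitely supported sequences $\nu=(\nu_j)_{j\in\mathbb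 N}$ of nonnegative integers; write $\nu!=\prod_j\nu_j!$ and $c^{\nu}=\prod_j c_j^{\nu_j}$. Let $H_k(x)=\frac{(-1)^k}{\sqrt{k!}}e^{x^2/2}\frac{d^k}{dx^k}e^{-x^2/2}$, $H_\nu(y)=\prod_jH_{\nu_j}(y_j)$, $u_\nu=\int_U u(y)H_\nu(y)\,d\gamma(y)\in V$, and $$\beta_\nu(r,\varrho)=\prod_{j}\sum_{\ell=0}^{r}\binom{\nu_j}{\ell}\varrho_j^{2\ell}.$$ Let $0<q<\infty$, let $\varrho=(\varrho_j)$ be a sequence of positive numbers with $(\varrho_j^{-1})\in\ell^q(\mathbb N)$, and let $r\in\mathbb N$ with $r>2/q$. Assume that for each $\nu\in\mathcal F$ there is a sequence $\rho_\nu=(\rho_{\nu,j})_j$ of nonnegative numbers with $\rho_{\nu,j}\neq0$ whenever $\nu_j\neq 0$, such that $$\sup_{\nu\in\mathcal F}\Big\|\sum_j\rho_{\nu,j}|\psi_j|\Big\|_{L^\infty(D)}\le\kappa<\frac{\pi}{2}\qquad\text{and}\qquad \sum_{\nu\in\mathcal F,\ \|\nu\|_{\ell^\infty}\le r}\frac{\nu!\,\varrho^{2\nu}}{\rho_\nu^{2\nu}}<\infty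 .$$ Then $\gamma$-almost every $y$ belongs to $U_0$, the weak solution $u(y)$ exists and is unique for every $y\in U_0$, $u\in L^2(U,V;\gamma)$ (so that the $u_\nu$ are well defined), $$\sum_{\nu\in\mathcal F}\beta_\nu(r,\varrho)\,\|u_\nu\|_V^2<\infty\qquad\text{and}\qquad \big(\beta_\nu(r,\varrho)^{-1/2}\big)_{\nu\in\mathcal F}\in\ell^q(\mathcal F),$$ and $(\|u_\nu\|_V)_{\nu\in\mathcal F}\in\ell^p(\mathcal F)$, where $\frac1p=\frac1q+\frac12$. -/

import Mathlib

open MeasureTheory ProbabilityTheory Filter Topology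
open scoped ENNReal ContDiff Nat Gradient

noncomputable section

namespace LogGaussian

/-- `ℝ^d` with the Euclidean norm. -/
abbrev Space (d : ℕ) : Type := EuclideanSpace ℝ (Fin d)

/-- `L^∞(D)`, real valued. -/
abbrev LInf {d : ℕ} (D : Set (Space d)) : Type := Lp ℝ ∞ (volume.restrict D)

/-- Pairs `(v, g)` in `L²(D) × L²(D; ℝ^d)` with the norm `(‖v‖² + ‖g‖²)^{1/2}`. For `g = ∇ v`
this is the norm of `H¹(D)`. -/
abbrev L2Pair {d : ℕ} (D : Set (Space d)) : Type :=
  WithLp 2 (Lp ℝ 2 (volume.restrict D) × Lp (Space d) 2 (volume.restrict D))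

/-- The pairs `(η, ∇ η)` with `η ∈ C_c^∞(D)`. -/
def testPairs {d : ℕ} (D : Set (Space d)) : Submodule ℝ (L2Pair D) where
  carrier := {p | ∃ η : Space d → ℝ, ContDiff ℝ ∞ η ∧ HasCompactSupport η ∧ tsupport η ⊆ D ∧
    (p.fst =ᵐ[volume.restrict D] η) ∧ (p.snd =ᵐ[volume.restrict D] ∇ η)}
  zero_mem' := by
    refine ⟨fun _ => 0, contDiff_const, HasCompactSupport.zero, ?_, ?_, ?_⟩
    · simp [tsupport]
    · exact Lp.coeFn_zero _ _ _
    · refine (Lp.coeFn_zero (Space d) 2 (volume.restrict D)).trans ?_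
      refine Eventually.of_forall fun x => ?_
      simp [gradient]
  add_mem' := by
    rintro p q ⟨η, hη, cη, sη, h1, h2⟩ ⟨θ, hθ, cθ, sθ, k1, k2⟩
    refine ⟨η + θ, hη.add hθ, cη.add cθ, (tsupport_add η θ).trans (Set.union_subset sη sθ), ?_, ?_⟩
    · exact (Lp.coeFn_add p.fst q.fst).trans (h1.add k1)
    · refine (Lp.coeFn_add p.snd q.snd).trans ((h2.add k2).trans ?_)
      refine Eventually.of_forall fun x => ?_
      have e := fderiv_add (𝕜 := ℝ) ((hη.differentiable (by simp)) x)
        ((hθ.differentiable (by simp)) x)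
      simp only [gradient, Pi.add_apply, e, map_add]
  smul_mem' := by
    rintro c p ⟨η, hη, cη, sη, h1, h2⟩
    refine ⟨c • η, hη.const_smul c, cη.smul_left (f := fun _ => c), ?_, ?_, ?_⟩
    · exact (closure_mono (Function.support_const_smul_subset c η)).trans sη
    · exact (Lp.coeFn_smul c p.fst).trans (h1.const_smul c)
    · refine (Lp.coeFn_smul c p.snd).trans ((h2.const_smul c).trans ?_)
      refine Eventually.of_forall fun x => ?_
      have e := fderiv_const_smul (𝕜 := ℝ) ((hη.differentiable (by simp)) x) c
      simp only [gradient, Pi.smul_apply, e, map_smul]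

/-- `V = H¹₀(D)`, the closure of `C_c^∞(D)` in the norm of `H¹(D)`; an element `v` is stored
together with its weak gradient, as the pair `(v, ∇ v)`. -/
abbrev H10 {d : ℕ} (D : Set (Space d)) : Submodule ℝ (L2Pair D) :=
  (testPairs D).topologicalClosure

/-- The weak gradient of `v ∈ H¹₀(D)`. -/
def grad {d : ℕ} {D : Set (Space d)} (v : H10 D) : Lp (Space d) 2 (volume.restrict D) :=
  (v : L2Pair D).snd

/-- The norm `‖v‖_V = ‖∇ v‖_{L²(D)}`. -/
def normV {d : ℕ} {D : Set (Space d)} (v : H10 D) : ℝ := ‖grad v‖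

/-- `u` is the weak solution of `-div (exp(b) ∇ u) = f` in `D`, `u = 0` on `∂D`. -/
def IsWeakSolution {d : ℕ} {D : Set (Space d)} (b : LInf D) (f : H10 D →L[ℝ] ℝ)
    (u : H10 D) : Prop :=
  ∀ v : H10 D, ∫ x in D, Real.exp (b x) * inner ℝ (grad u x) (grad v x) = f v

/-- `b = b(y)`: the series `∑_j y_j ψ_j` converges almost everywhere in `D` to `b ∈ L^∞(D)`. -/
def IsLogCoeff {d : ℕ} {D : Set (Space d)} (ψ : ℕ → LInf D) (y : ℕ → ℝ) (b : LInf D) : Prop :=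
  ∀ᵐ x ∂(volume.restrict D),
    Tendsto (fun n => ∑ j ∈ Finset.range n, y j * ψ j x) atTop (𝓝 (b x))

/-- The set `U₀` of the parameters `y` with `b(y) ∈ L^∞(D)`. -/
def U0 {d : ℕ} {D : Set (Space d)} (ψ : ℕ → LInf D) : Set (ℕ → ℝ) :=
  {y | ∃ b : LInf D, IsLogCoeff ψ y b}

open Classical in
/-- The parametric solution `y ↦ u(y) ∈ H¹₀(D)`, with the value `0` outside of `U₀`. -/
def solution {d : ℕ} {D : Set (Space d)} (ψ : ℕ → LInf D) (f : H10 D →L[ℝ] ℝ)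
    (y : ℕ → ℝ) : H10 D :=
  if h : ∃ u : H10 D, ∃ b : LInf D, IsLogCoeff ψ y b ∧ IsWeakSolution b f u then h.choose else 0

/-- The standing assumption on the functions `ψ_j`: there are `λ_j > 0` such that
`(exp(-λ_j²)) ∈ ℓ¹` and `∑_j λ_j |ψ_j|` converges in `L^∞(D)`. -/
def SeriesAssumption {d : ℕ} {D : Set (Space d)} (ψ : ℕ → LInf D) : Prop :=
  ∃ lam : ℕ → ℝ, (∀ j, 0 < lam j) ∧ Summable (fun j => Real.exp (-(lam j) ^ 2)) ∧
    ∃ S : LInf D, Tendsto (fun n => ∑ j ∈ Finset.range n, lam j • |ψ j|) atTop (𝓝 S)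

/-- The standard Gaussian measure on `ℝ^ℕ`. -/
def gaussian : Measure (ℕ → ℝ) := Measure.infinitePi fun _ : ℕ => gaussianReal 0 1

/-- The normalized probabilistic Hermite polynomial `H_k`. -/
def hermiteN (k : ℕ) (x : ℝ) : ℝ :=
  Polynomial.aeval x (Polynomial.hermite k) / √(k ! : ℝ)

/-- `H_ν(y) = ∏_j H_{ν_j}(y_j)`; the factors with `ν_j = 0` are `1`. -/
def hermiteMulti (ν : ℕ →₀ ℕ) (y : ℕ → ℝ) : ℝ := ν.prod fun j k => hermiteN k (y j)

/-- The Wiener-Hermite coefficient `u_ν = ∫ u(y) H_ν(y) dγ(y)`. -/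
def hermiteCoeff {X : Type*} [NormedAddCommGroup X] [NormedSpace ℝ X] (u : (ℕ → ℝ) → X)
    (ν : ℕ →₀ ℕ) : X :=
  ∫ y, hermiteMulti ν y • u y ∂gaussian

/-- `ν! = ∏_j ν_j!`. -/
def multiFactorial (ν : ℕ →₀ ℕ) : ℝ := ν.prod fun _ k => (k ! : ℝ)

/-- `c^ν = ∏_j c_j^{ν_j}`. -/
def multiPow (c : ℕ → ℝ) (ν : ℕ →₀ ℕ) : ℝ := ν.prod fun j k => c j ^ k

/-- The weight `β_ν(r, ϱ) = ∏_j ∑_{l ≤ r} (ν_j choose l) ϱ_j^{2 l}`; the factors with `ν_j = 0`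
are `1`. -/
def beta (r : ℕ) (ϱ : ℕ → ℝ) (ν : ℕ →₀ ℕ) : ℝ :=
  ν.prod fun j k => ∑ l ∈ Finset.range (r + 1), (k.choose l : ℝ) * ϱ j ^ (2 * l)

end LogGaussian

end

/-!
For complex coefficients `b ∈ L^∞(D; ℂ)` with `‖Im b‖ < π / 2` the real part of `exp b` is bounded
from below, so that `b ↦ u(b)` extends to a holomorphic map on this strip which grows at most like
`exp ‖Re b‖` where `‖Im b‖ ≤ κ < π / 2`. The condition `∑ⱼ ρⱼ |ψⱼ| ≤ κ` fits a polydisc of radii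
`ρⱼ` in the directions `ψⱼ` into the strip `‖Im b‖ ≤ κ`, and Cauchy's estimates give
`‖∂^μ u(y)‖ ≤ C μ! ρ^{-μ} exp ‖b(y)‖`, where `exp ‖b‖` is square integrable because of the
assumption on the series. Gaussian integration by parts turns derivatives into shifts of the Hermite
coefficients: `(∂^μ u)_α = √((α + μ)! / α!) u_{α + μ}`. By Bessel's inequality
`∑_α (α + μ choose μ) ‖u_{α + μ}‖² ≤ C' μ! ρ_μ^{-2μ}`. Since
`β_ν(r, ϱ) = ∑_{‖μ‖_∞ ≤ r} (ν choose μ) ϱ^{2μ}`, summing these bounds with the weights `ϱ^{2μ}`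
yields the weighted `ℓ²` summability; Hölder's inequality gives the `ℓ^p` summability.
-/

noncomputable section

namespace LogGaussian

section InfinitePi

variable {ι : Type*} {X : ι → Type*} [∀ i, MeasurableSpace (X i)] {μ : ∀ i, Measure (X i)}
  [∀ i, IsProbabilityMeasure (μ i)] {F : Type*} [NormedAddCommGroup F]

lemma measurePreserving_update_infinitePi [DecidableEq ι] (j : ι) :
    MeasurePreserving (fun p : X j × (∀ i, X i) => Function.update p.2 j p.1)
      ((μ j).prod (Measure.infinitePi μ)) (Measure.infinitePi μ) := by
  have hmeas : Measurable (fun p : X j × (∀ i, X i) => Function.update p.2 j p.1) :=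
    measurable_update'.comp measurable_swap
  refine ⟨hmeas, Measure.eq_infinitePi (μ := μ) fun s t ht => ?_⟩
  have hpre : (fun p : X j × (∀ i, X i) => Function.update p.2 j p.1) ⁻¹' Set.pi s t =
      (if j ∈ s then t j else Set.univ) ×ˢ Set.pi (s.erase j) t := by
    ext ⟨x, y⟩
    simp only [Set.mem_preimage, Set.mem_pi, Set.mem_prod, Finset.mem_coe, Finset.mem_erase]
    refine ⟨fun h => ⟨?_, fun i hi => by simpa [hi.1] using h i hi.2⟩, fun h i hi => ?_⟩
    · split_ifs with hj
      · simpa using h j hj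
      · trivial
    · obtain rfl | hij := eq_or_ne i j
      · simpa [hi] using h.1
      · simpa [hij] using h.2 i ⟨hij, hi⟩
  rw [Measure.map_apply hmeas (MeasurableSet.pi s.countable_toSet fun i _ => ht i), hpre,
    Measure.prod_prod, Measure.infinitePi_pi _ fun i _ => ht i]
  split_ifs with hj
  · exact Finset.mul_prod_erase s (fun i => μ i (t i)) hj
  · rw [measure_univ, one_mul, Finset.erase_eq_of_notMem hj]

lemma integrable_comp_update [DecidableEq ι] {f : (∀ i, X i) → F}
    (hf : Integrable f (Measure.infinitePi μ)) (j : ι) :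
    Integrable (fun p : X j × (∀ i, X i) => f (Function.update p.2 j p.1))
      ((μ j).prod (Measure.infinitePi μ)) :=
  ((measurePreserving_update_infinitePi j).integrable_comp hf.aestronglyMeasurable).2 hf

lemma ae_integrable_update [DecidableEq ι] {f : (∀ i, X i) → F}
    (hf : Integrable f (Measure.infinitePi μ)) (j : ι) :
    ∀ᵐ y ∂Measure.infinitePi μ, Integrable (fun t => f (Function.update y j t)) (μ j) :=
  (integrable_comp_update hf j).prod_left_ae

lemma integral_eq_integral_integral_update [DecidableEq ι] [NormedSpace ℝ F]
    {f : (∀ i, X i) → F} (hf : Integrable f (Measure.infinitePi μ)) (j : ι) :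
    ∫ y, f y ∂Measure.infinitePi μ =
      ∫ y, ∫ t, f (Function.update y j t) ∂μ j ∂Measure.infinitePi μ := by
  have hmp := measurePreserving_update_infinitePi (μ := μ) j
  rw [← hmp.map_eq, integral_map hmp.aemeasurable (by rw [hmp.map_eq]; exact hf.1), hmp.map_eq]
  exact integral_prod_symm _ (integrable_comp_update hf j)

end InfinitePi

section InfinitePiProd

variable {ι Ω : Type*} [MeasurableSpace Ω] {μ : ι → Measure Ω} [∀ i, IsProbabilityMeasure (μ i)]
  {g : ι → Ω → ℝ}

lemma integrable_finsetProd_infinitePi (hg : ∀ i, Integrable (g i) (μ i)) (s : Finset ι) :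
    Integrable (fun y : ι → Ω => ∏ i ∈ s, g i (y i)) (Measure.infinitePi μ) := by
  have hint : Integrable (fun z : s → Ω => ∏ i : s, g i (z i)) (Measure.pi fun i : s => μ i) :=
    Integrable.fintype_prod (f := fun i : s => g i) fun i => hg i
  have hmp : MeasurePreserving s.restrict (Measure.infinitePi μ) (Measure.pi fun i : s => μ i) :=
    ⟨Finset.measurable_restrict s, Measure.infinitePi_map_restrict μ⟩
  refine ((hmp.integrable_comp hint.aestronglyMeasurable).2 hint).congr (ae_of_all _ fun y => ?_)
  exact Finset.prod_coe_sort s fun i => g i (y i)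

lemma integral_finsetProd_infinitePi (hg : ∀ i, Integrable (g i) (μ i)) (s : Finset ι) :
    ∫ y, ∏ i ∈ s, g i (y i) ∂Measure.infinitePi μ = ∏ i ∈ s, ∫ t, g i t ∂μ i := by
  have hint : Integrable (fun z : s → Ω => ∏ i : s, g i (z i)) (Measure.pi fun i : s => μ i) :=
    Integrable.fintype_prod (f := fun i : s => g i) fun i => hg i
  calc ∫ y, ∏ i ∈ s, g i (y i) ∂Measure.infinitePi μ
      = ∫ y, ∏ i : s, g i (s.restrict y i) ∂Measure.infinitePi μ := by
        simp only [← Finset.prod_coe_sort s, Finset.restrict]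
    _ = ∫ z, ∏ i : s, g i (z i) ∂Measure.pi fun i : s => μ i :=
        integral_restrict_infinitePi (X := fun _ => Ω) (f := fun z : s → Ω => ∏ i : s, g i (z i)) μ
          hint.aestronglyMeasurable
    _ = ∏ i ∈ s, ∫ t, g i t ∂μ i := by
        rw [integral_fintype_prod_eq_prod (fun i : s => g i)]
        exact Finset.prod_coe_sort s fun i => ∫ t, g i t ∂μ i

end InfinitePiProd

section Bessel

variable {ι Ω X : Type*} [MeasurableSpace Ω] {μ : Measure Ω} [NormedAddCommGroup X]

lemma integrable_smul_of_memLp_two [NormedSpace ℝ X] {e : Ω → ℝ} {w : Ω → X} (he : MemLp e 2 μ)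
    (hw : MemLp w 2 μ) : Integrable (fun x => e x • w x) μ :=
  memLp_one_iff_integrable.1 (hw.smul he)

variable [InnerProductSpace ℝ X] {e : ι → Ω → ℝ} {w : Ω → X}

lemma inner_sum_smul (s : Finset ι) (a : ι → ℝ) (c : ι → X) (v : X) :
    inner ℝ (∑ i ∈ s, a i • c i) v = ∑ i ∈ s, inner ℝ (c i) (a i • v) := by
  simp only [sum_inner, real_inner_smul_left, real_inner_smul_right]

lemma integrable_inner_sum_smul (he : ∀ i, MemLp (e i) 2 μ) (hw : MemLp w 2 μ) (s : Finset ι)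
    (c : ι → X) : Integrable (fun x => inner ℝ (∑ i ∈ s, e i x • c i) (w x)) μ := by
  simp only [inner_sum_smul]
  exact integrable_finsetSum _ fun i _ => (integrable_smul_of_memLp_two (he i) hw).const_inner _

variable [CompleteSpace X]

lemma integral_inner_sum_smul (he : ∀ i, MemLp (e i) 2 μ) (hw : MemLp w 2 μ) (s : Finset ι)
    (c : ι → X) :
    ∫ x, inner ℝ (∑ i ∈ s, e i x • c i) (w x) ∂μ =
      ∑ i ∈ s, inner ℝ (c i) (∫ x, e i x • w x ∂μ) := by
  have hint := fun i => integrable_smul_of_memLp_two (he i) hw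
  simp only [inner_sum_smul]
  rw [integral_finsetSum _ fun i _ => (hint i).const_inner _]
  exact Finset.sum_congr rfl fun i _ => integral_inner (hint i) _

lemma integral_smul_sum_smul_of_orthonormal [DecidableEq ι] (he : ∀ i, MemLp (e i) 2 μ)
    (horth : ∀ i j, ∫ x, e i x * e j x ∂μ = if i = j then 1 else 0) {s : Finset ι} {i : ι}
    (hi : i ∈ s) (c : ι → X) : ∫ x, e i x • ∑ j ∈ s, e j x • c j ∂μ = c i := by
  have hint : ∀ j, Integrable (fun x => (e i x * e j x) • c j) μ := fun j =>
    ((he i).integrable_mul (he j)).smul_const (c j)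
  simp only [Finset.smul_sum, smul_smul]
  rw [integral_finsetSum _ fun j _ => hint j]
  simp only [integral_smul_const, horth, ite_smul, one_smul, zero_smul, Finset.sum_ite_eq, hi,
    if_true]

lemma sum_norm_integral_smul_sq_le [DecidableEq ι] (he : ∀ i, MemLp (e i) 2 μ)
    (horth : ∀ i j, ∫ x, e i x * e j x ∂μ = if i = j then 1 else 0) (hw : MemLp w 2 μ)
    (s : Finset ι) :
    ∑ i ∈ s, ‖∫ x, e i x • w x ∂μ‖ ^ 2 ≤ ∫ x, ‖w x‖ ^ 2 ∂μ := by
  set c : ι → X := fun i => ∫ x, e i x • w x ∂μ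
  set S : Ω → X := fun x => ∑ i ∈ s, e i x • c i
  have hS : MemLp S 2 μ :=
    memLp_finsetSum s fun i _ => (memLp_top_const (c i)).smul (he i) (r := 2)
  have hSw : ∫ x, inner ℝ (S x) (w x) ∂μ = ∑ i ∈ s, ‖c i‖ ^ 2 := by
    rw [integral_inner_sum_smul he hw]
    exact Finset.sum_congr rfl fun i _ => real_inner_self_eq_norm_sq _
  have hSS : ∫ x, inner ℝ (S x) (S x) ∂μ = ∑ i ∈ s, ‖c i‖ ^ 2 := by
    rw [integral_inner_sum_smul he hS]
    refine Finset.sum_congr rfl fun i hi => ?_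
    rw [integral_smul_sum_smul_of_orthonormal he horth hi, real_inner_self_eq_norm_sq]
  have hww : Integrable (fun x => ‖w x‖ ^ 2) μ := by
    simpa using hw.integrable_norm_pow two_ne_zero
  have hexp : ∀ x, ‖S x - w x‖ ^ 2 =
      inner ℝ (S x) (S x) - 2 * inner ℝ (S x) (w x) + ‖w x‖ ^ 2 := fun x => by
    rw [norm_sub_sq_real, real_inner_self_eq_norm_sq]
  have hnonneg : 0 ≤ ∫ x, ‖S x - w x‖ ^ 2 ∂μ := integral_nonneg fun x => sq_nonneg _
  have hiS : Integrable (fun x => inner ℝ (S x) (S x)) μ := integrable_inner_sum_smul he hS s c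
  have hiw : Integrable (fun x => 2 * inner ℝ (S x) (w x)) μ :=
    (integrable_inner_sum_smul he hw s c).const_mul 2
  simp only [hexp] at hnonneg
  rw [integral_add (by exact hiS.sub hiw) hww, integral_sub hiS hiw, integral_const_mul, hSw, hSS]
    at hnonneg
  linarith

end Bessel

section Hermite

lemma hermiteN_zero : hermiteN 0 = fun _ => 1 := by
  funext x
  simp [hermiteN]

lemma continuous_hermiteN (k : ℕ) : Continuous (hermiteN k) :=
  (Polynomial.hermite k).continuous_aeval.div_const _

lemma sqrt_factorial_succ (k : ℕ) : √((k + 1)! : ℝ) = √((k : ℝ) + 1) * √(k ! : ℝ) := by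
  rw [Nat.factorial_succ, Nat.cast_mul, Real.sqrt_mul (by positivity), Nat.cast_succ]

lemma derivative_hermite_succ (n : ℕ) :
    Polynomial.derivative (Polynomial.hermite (n + 1)) =
      ((n + 1 : ℕ) : Polynomial ℤ) * Polynomial.hermite n := by
  induction n with
  | zero => simp
  | succ n ih =>
    rw [Polynomial.hermite_succ (n + 1), Polynomial.derivative_sub, Polynomial.derivative_mul, ih,
      Polynomial.derivative_X, Polynomial.derivative_mul, Polynomial.derivative_natCast,
      Polynomial.hermite_succ n]
    push_cast
    ring

lemma hasDerivAt_hermiteN_succ (k : ℕ) (x : ℝ) :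
    HasDerivAt (hermiteN (k + 1)) (√((k : ℝ) + 1) * hermiteN k x) x := by
  refine (((Polynomial.hermite (k + 1)).hasDerivAt_aeval x).div_const _).congr_deriv ?_
  have hk : (0 : ℝ) < (k : ℝ) + 1 := by positivity
  rw [derivative_hermite_succ, map_mul, map_natCast, hermiteN, sqrt_factorial_succ, Nat.cast_succ]
  field_simp
  rw [Real.sq_sqrt hk.le]
  ring

lemma hasDerivAt_gaussianPDFReal (μ : ℝ) (v : NNReal) (x : ℝ) :
    HasDerivAt (gaussianPDFReal μ v) (-((x - μ) / v) * gaussianPDFReal μ v x) x := by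
  have hexponent : HasDerivAt (fun t : ℝ => -(t - μ) ^ 2 / (2 * (v : ℝ))) (-((x - μ) / v)) x := by
    refine ((((hasDerivAt_id x).sub_const μ).pow 2).neg.div_const (2 * (v : ℝ))).congr_deriv ?_
    rw [Nat.cast_ofNat, pow_one, mul_one, id, neg_div, mul_div_mul_left _ _ two_ne_zero]
  rw [gaussianPDFReal_def]
  exact (hexponent.exp.const_mul _).congr_deriv (by ring)

lemma hasDerivAt_gaussianPDFReal_mul_hermiteN (k : ℕ) (x : ℝ) :
    HasDerivAt (fun t => gaussianPDFReal 0 1 t * hermiteN k t)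
      (-√((k : ℝ) + 1) * (gaussianPDFReal 0 1 x * hermiteN (k + 1) x)) x := by
  refine ((hasDerivAt_gaussianPDFReal 0 1 x).mul
    (((Polynomial.hermite k).hasDerivAt_aeval x).div_const _)).congr_deriv ?_
  rw [hermiteN, sqrt_factorial_succ, Polynomial.hermite_succ, map_sub, map_mul,
    Polynomial.aeval_X, NNReal.coe_one]
  field_simp
  ring

lemma integrable_gaussianPDFReal_smul_iff {X : Type*} [NormedAddCommGroup X] [NormedSpace ℝ X]
    {μ : ℝ} {v : NNReal} (hv : v ≠ 0) {f : ℝ → X} :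
    Integrable (fun x => gaussianPDFReal μ v x • f x) ↔ Integrable f (gaussianReal μ v) := by
  rw [gaussianReal_of_var_ne_zero _ hv, integrable_withDensity_iff_integrable_smul'
    (measurable_gaussianPDF μ v) (ae_of_all _ fun _ => gaussianPDF_lt_top)]
  simp only [toReal_gaussianPDF]

lemma integral_hermiteN_smul_deriv {X : Type*} [NormedAddCommGroup X] [NormedSpace ℝ X]
    {g g' : ℝ → X} (hderiv : ∀ t, HasDerivAt g (g' t) t) (k : ℕ)
    (hg' : Integrable (fun t => hermiteN k t • g' t) (gaussianReal 0 1))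
    (hg_succ : Integrable (fun t => hermiteN (k + 1) t • g t) (gaussianReal 0 1))
    (hg : Integrable (fun t => hermiteN k t • g t) (gaussianReal 0 1)) :
    ∫ t, hermiteN k t • g' t ∂gaussianReal 0 1 =
      √((k : ℝ) + 1) • ∫ t, hermiteN (k + 1) t • g t ∂gaussianReal 0 1 := by
  rw [← integrable_gaussianPDFReal_smul_iff one_ne_zero] at hg' hg_succ hg
  have hparts := integral_bilinear_hasDerivAt_right_eq_neg_left_of_integrable
    (L := ContinuousLinearMap.lsmul ℝ ℝ (E := X))
    (fun t _ => hasDerivAt_gaussianPDFReal_mul_hermiteN k t) (fun t _ => hderiv t)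
    (by simpa only [ContinuousLinearMap.lsmul_apply, mul_smul] using hg')
    (by simpa only [ContinuousLinearMap.lsmul_apply, mul_smul, Pi.smul_def] using
      hg_succ.smul (-√((k : ℝ) + 1)))
    (by simpa only [ContinuousLinearMap.lsmul_apply, mul_smul] using hg)
  simp only [ContinuousLinearMap.lsmul_apply, mul_smul, neg_smul, integral_neg, integral_smul,
    neg_neg] at hparts
  rwa [integral_gaussianReal_eq_integral_smul one_ne_zero,
    integral_gaussianReal_eq_integral_smul one_ne_zero]

lemma integrable_eval_gaussianReal (p : Polynomial ℝ) (μ : ℝ) (v : NNReal) :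
    Integrable (fun x => p.eval x) (gaussianReal μ v) := by
  simp only [Polynomial.eval_eq_sum_range]
  refine integrable_finsetSum _ fun i _ => Integrable.const_mul ?_ _
  have hpow := (memLp_id_gaussianReal' (μ := μ) (v := v) i
    (ENNReal.natCast_ne_top i)).integrable_norm_pow'
  exact hpow.mono' (by fun_prop) (ae_of_all _ fun x => (norm_pow x i).le)

lemma integrable_hermiteN_mul (k l : ℕ) :
    Integrable (fun x => hermiteN k x * hermiteN l x) (gaussianReal 0 1) := by
  have hpoly := integrable_eval_gaussianReal ((Polynomial.hermite k).map (Int.castRingHom ℝ) *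
    (Polynomial.hermite l).map (Int.castRingHom ℝ)) 0 1
  refine (hpoly.div_const (√(k ! : ℝ) * √(l ! : ℝ))).congr (ae_of_all _ fun x => ?_)
  simp only [hermiteN, Polynomial.eval_mul, Polynomial.aeval_def, Polynomial.eval_map,
    algebraMap_int_eq, div_mul_div_comm]

lemma integral_hermiteN_succ (k : ℕ) : ∫ x, hermiteN (k + 1) x ∂gaussianReal 0 1 = 0 := by
  have hint := fun k => integrable_hermiteN_mul k 0
  simp only [hermiteN_zero] at hint
  have hparts := integral_hermiteN_smul_deriv (fun t => hasDerivAt_const t (1 : ℝ)) k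
    (by simp) (hint (k + 1)) (hint k)
  simp only [smul_eq_mul, mul_zero, mul_one, integral_zero, zero_eq_mul] at hparts
  exact hparts.resolve_left (by positivity)

lemma integral_hermiteN_succ_mul_succ (k l : ℕ) :
    √((k : ℝ) + 1) * ∫ x, hermiteN (k + 1) x * hermiteN (l + 1) x ∂gaussianReal 0 1 =
      √((l : ℝ) + 1) * ∫ x, hermiteN k x * hermiteN l x ∂gaussianReal 0 1 := by
  have hparts := integral_hermiteN_smul_deriv (hasDerivAt_hermiteN_succ l) k
    (by simpa only [smul_eq_mul, mul_left_comm] using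
      (integrable_hermiteN_mul k l).const_mul √((l : ℝ) + 1))
    (integrable_hermiteN_mul (k + 1) (l + 1)) (integrable_hermiteN_mul k (l + 1))
  simp only [smul_eq_mul, mul_left_comm _ √((l : ℝ) + 1), integral_const_mul] at hparts
  exact hparts.symm

lemma integral_hermiteN_mul (k l : ℕ) :
    ∫ x, hermiteN k x * hermiteN l x ∂gaussianReal 0 1 = if k = l then 1 else 0 := by
  induction k generalizing l with
  | zero =>
    cases l with
    | zero => simp [hermiteN_zero]
    | succ l => simp [hermiteN_zero, integral_hermiteN_succ]
  | succ k ih =>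
    cases l with
    | zero => simp [hermiteN_zero, integral_hermiteN_succ]
    | succ l =>
      have hk : √((k : ℝ) + 1) ≠ 0 := by positivity
      refine mul_left_cancel₀ hk ((integral_hermiteN_succ_mul_succ k l).trans ?_)
      rw [ih]
      obtain rfl | hkl := eq_or_ne k l
      · simp
      · simp [hkl]

end Hermite

section HermiteMulti

variable {X : Type*} [NormedAddCommGroup X]

instance isProbabilityMeasure_gaussian : IsProbabilityMeasure gaussian :=
  inferInstanceAs (IsProbabilityMeasure (Measure.infinitePi fun _ : ℕ => gaussianReal 0 1))

lemma hermiteMulti_eq_prod {s : Finset ℕ} {ν : ℕ →₀ ℕ} (hs : ν.support ⊆ s) (y : ℕ → ℝ) :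
    hermiteMulti ν y = ∏ j ∈ s, hermiteN (ν j) (y j) :=
  Finsupp.prod_of_support_subset _ hs _ fun j _ => congrFun hermiteN_zero (y j)

lemma hermiteMulti_update (ν : ℕ →₀ ℕ) (j : ℕ) (y : ℕ → ℝ) (t : ℝ) :
    hermiteMulti ν (Function.update y j t) = hermiteN (ν j) t * hermiteMulti (ν.erase j) y := by
  unfold hermiteMulti
  rw [← Finsupp.mul_prod_erase' ν j _ fun i => congrFun hermiteN_zero _, Function.update_self]
  refine congrArg _ (Finset.prod_congr rfl fun i hi => ?_)
  have hij : i ≠ j := by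
    rintro rfl
    simp at hi
  simp only [Function.update_of_ne hij]

lemma measurable_hermiteMulti (ν : ℕ →₀ ℕ) : Measurable (hermiteMulti ν) :=
  Finset.measurable_prod _ fun j _ =>
    (continuous_hermiteN _).measurable.comp (measurable_pi_apply j)

lemma integrable_hermiteMulti_mul (ν μ : ℕ →₀ ℕ) :
    Integrable (fun y => hermiteMulti ν y * hermiteMulti μ y) gaussian := by
  simp only [hermiteMulti_eq_prod (s := ν.support ∪ μ.support) Finset.subset_union_left,
    hermiteMulti_eq_prod (s := ν.support ∪ μ.support) Finset.subset_union_right,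
    ← Finset.prod_mul_distrib]
  exact integrable_finsetProd_infinitePi (fun j => integrable_hermiteN_mul (ν j) (μ j)) _

lemma integral_hermiteMulti_mul (ν μ : ℕ →₀ ℕ) :
    ∫ y, hermiteMulti ν y * hermiteMulti μ y ∂gaussian = if ν = μ then 1 else 0 := by
  simp only [hermiteMulti_eq_prod (s := ν.support ∪ μ.support) Finset.subset_union_left,
    hermiteMulti_eq_prod (s := ν.support ∪ μ.support) Finset.subset_union_right,
    ← Finset.prod_mul_distrib]
  refine (integral_finsetProd_infinitePi (fun j => integrable_hermiteN_mul (ν j) (μ j)) _).trans ?_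
  simp only [integral_hermiteN_mul]
  split_ifs with hνμ
  · simp [hνμ]
  · obtain ⟨j, hj⟩ := DFunLike.ne_iff.1 hνμ
    refine Finset.prod_eq_zero (i := j) ?_ (if_neg hj)
    rw [Finset.mem_union, Finsupp.mem_support_iff, Finsupp.mem_support_iff]
    omega

lemma memLp_hermiteMulti (ν : ℕ →₀ ℕ) : MemLp (hermiteMulti ν) 2 gaussian := by
  rw [memLp_two_iff_integrable_sq (measurable_hermiteMulti ν).aestronglyMeasurable]
  simpa only [sq] using integrable_hermiteMulti_mul ν ν

lemma integrable_hermiteMulti_smul [NormedSpace ℝ X] {w : (ℕ → ℝ) → X} (hw : MemLp w 2 gaussian)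
    (ν : ℕ →₀ ℕ) : Integrable (fun y => hermiteMulti ν y • w y) gaussian :=
  integrable_smul_of_memLp_two (memLp_hermiteMulti ν) hw

lemma hermiteCoeff_deriv [NormedSpace ℝ X] {w w' : (ℕ → ℝ) → X} (hw : MemLp w 2 gaussian)
    (hw' : MemLp w' 2 gaussian) (j : ℕ)
    (hderiv : ∀ᵐ y ∂gaussian, ∀ t, HasDerivAt (fun t => w (Function.update y j t))
      (w' (Function.update y j t)) t) (ν : ℕ →₀ ℕ) :
    hermiteCoeff w' ν = √((ν j : ℝ) + 1) • hermiteCoeff w (ν + Finsupp.single j 1) := by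
  have hint' := integrable_hermiteMulti_smul hw' ν
  have hint_succ := integrable_hermiteMulti_smul hw (ν + Finsupp.single j 1)
  have hint := integrable_hermiteMulti_smul hw ν
  refine (integral_eq_integral_integral_update hint' j).trans ?_
  refine Eq.trans ?_ (congrArg _ (integral_eq_integral_integral_update hint_succ j).symm)
  rw [← integral_smul]
  refine integral_congr_ae ?_
  filter_upwards [hderiv, ae_integrable_update hint' j, ae_integrable_update hint_succ j,
    ae_integrable_update hint j] with y hy hy' hy_succ hy_self
  have herase : (ν + Finsupp.single j 1).erase j = ν.erase j := by
    simp [Finsupp.erase_add]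
  simp only [hermiteMulti_update, herase, Finsupp.add_apply, Finsupp.single_eq_same, mul_smul]
    at hy' hy_succ hy_self ⊢
  exact integral_hermiteN_smul_deriv (fun t => (hy t).const_smul _) (ν j) hy' hy_succ hy_self

lemma sum_norm_hermiteCoeff_sq_le [InnerProductSpace ℝ X] [CompleteSpace X]
    {w : (ℕ → ℝ) → X} (hw : MemLp w 2 gaussian) (s : Finset (ℕ →₀ ℕ)) :
    ∑ ν ∈ s, ‖hermiteCoeff w ν‖ ^ 2 ≤ ∫ y, ‖w y‖ ^ 2 ∂gaussian :=
  sum_norm_integral_smul_sq_le memLp_hermiteMulti integral_hermiteMulti_mul hw s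

lemma hermiteCoeff_comp [NormedSpace ℝ X] {Y : Type*} [NormedAddCommGroup Y] [NormedSpace ℝ Y]
    [CompleteSpace X] [CompleteSpace Y] (T : X →L[ℝ] Y) {w : (ℕ → ℝ) → X}
    (hw : MemLp w 2 gaussian) (ν : ℕ →₀ ℕ) :
    hermiteCoeff (fun y => T (w y)) ν = T (hermiteCoeff w ν) := by
  simp only [hermiteCoeff, ← map_smul]
  exact T.integral_comp_comm (integrable_hermiteMulti_smul hw ν)

end HermiteMulti

section MultiIndexSums

lemma sum_finsupp_prod {ι M : Type*} [Zero M] {R : Type*} [CommSemiring R]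
    (s : Finset ι) (t : ι → Finset M) (a : ι → M → R) (ha : ∀ j, a j 0 = 1) :
    ∑ ν ∈ s.finsupp t, ν.prod a = ∏ j ∈ s, ∑ k ∈ t j, a j k := by
  classical
  rw [Finset.prod_sum, Finset.finsupp, Finset.sum_map]
  refine Finset.sum_congr (by congr!) fun p _ => ?_
  rw [Function.Embedding.coeFn_mk,
    Finsupp.prod_of_support_subset _ (Finsupp.support_indicator_subset s p) a fun j _ => ha j,
    ← Finset.prod_attach]
  simp

lemma exists_subset_finsupp_range {ι : Type*} (T : Finset (ι →₀ ℕ)) :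
    ∃ (s : Finset ι) (K : ℕ), T ⊆ s.finsupp fun _ => Finset.range (K + 1) := by
  classical
  refine ⟨T.biUnion Finsupp.support, T.sup Finsupp.degree, fun ν hν => ?_⟩
  refine Finset.mem_finsupp_iff.2 ⟨Finset.subset_biUnion_of_mem _ hν, fun i _ => ?_⟩
  rw [Finset.mem_range, Nat.lt_succ_iff]
  exact (Finsupp.le_degree i ν).trans (Finset.le_sup (f := Finsupp.degree) hν)

lemma summable_finsupp_prod {ι : Type*} {a : ι → ℕ → ℝ} (ha : ∀ j, a j 0 = 1)
    (hnonneg : ∀ j k, 0 ≤ a j k) {S : ι → ℝ} (hS : Summable S)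
    (hle : ∀ j K, ∑ k ∈ Finset.range K, a j (k + 1) ≤ S j) :
    Summable fun ν : ι →₀ ℕ => ν.prod a := by
  classical
  have hprod_nonneg (ν : ι →₀ ℕ) : 0 ≤ ν.prod a := Finset.prod_nonneg fun j _ => hnonneg _ _
  refine summable_of_sum_le (c := Real.exp (∑' j, S j)) hprod_nonneg fun T => ?_
  obtain ⟨s, K, hT⟩ := exists_subset_finsupp_range T
  have hfactor (j : ι) : ∑ k ∈ Finset.range (K + 1), a j k ≤ Real.exp (S j) := by
    rw [Finset.sum_range_succ', ha]
    exact (add_le_add_left (hle j K) 1).trans (Real.add_one_le_exp (S j))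
  calc ∑ ν ∈ T, ν.prod a ≤ ∑ ν ∈ s.finsupp fun _ => Finset.range (K + 1), ν.prod a :=
        Finset.sum_le_sum_of_subset_of_nonneg hT fun ν _ _ => hprod_nonneg ν
    _ = ∏ j ∈ s, ∑ k ∈ Finset.range (K + 1), a j k := sum_finsupp_prod _ _ _ ha
    _ ≤ ∏ j ∈ s, Real.exp (S j) :=
        Finset.prod_le_prod (fun j _ => Finset.sum_nonneg fun k _ => hnonneg _ _)
          fun j _ => hfactor j
    _ = Real.exp (∑ j ∈ s, S j) := (Real.exp_sum s S).symm
    _ ≤ Real.exp (∑' j, S j) :=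
        Real.exp_le_exp.2 (hS.sum_le_tsum s fun j _ => by simpa using hle j 0)

end MultiIndexSums

section Beta

/-- The factor `∑_{l ≤ r} (k choose l) x^{2 l}` of `β_ν(r, ϱ)` for `k = ν_j` and `x = ϱ_j`. -/
def betaFactor (r : ℕ) (x : ℝ) (k : ℕ) : ℝ :=
  ∑ l ∈ Finset.range (r + 1), (k.choose l : ℝ) * x ^ (2 * l)

lemma beta_eq_prod_betaFactor (r : ℕ) (ϱ : ℕ → ℝ) (ν : ℕ →₀ ℕ) :
    beta r ϱ ν = ν.prod fun j => betaFactor r (ϱ j) := rfl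

lemma betaFactor_zero (r : ℕ) (x : ℝ) : betaFactor r x 0 = 1 := by
  rw [betaFactor, Finset.sum_range_succ']
  simp

lemma choose_mul_pow_le_betaFactor {r l : ℕ} (hl : l ≤ r) (x : ℝ) (k : ℕ) :
    (k.choose l : ℝ) * x ^ (2 * l) ≤ betaFactor r x k :=
  Finset.single_le_sum (f := fun l => (k.choose l : ℝ) * x ^ (2 * l))
    (fun l _ => mul_nonneg (Nat.cast_nonneg _) ((even_two_mul l).pow_nonneg x))
    (Finset.mem_range.2 (Nat.lt_succ_of_le hl))

lemma betaFactor_pos (r : ℕ) (x : ℝ) (k : ℕ) : 0 < betaFactor r x k := by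
  refine zero_lt_one.trans_le ?_
  simpa using choose_mul_pow_le_betaFactor (Nat.zero_le r) x k

lemma beta_pos (r : ℕ) (ϱ : ℕ → ℝ) (ν : ℕ →₀ ℕ) : 0 < beta r ϱ ν :=
  Finset.prod_pos fun _ _ => betaFactor_pos _ _ _

lemma choose_min_mul_sq_le_betaFactor {r k : ℕ} (hr : 1 ≤ r) (hk : 1 ≤ k) {A x : ℝ} (hA : 1 ≤ A)
    (hAx : 1 ≤ A * x) :
    (k.choose (min k r) : ℝ) * x ^ 2 / A ^ (2 * (r - 1)) ≤ betaFactor r x k := by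
  obtain ⟨m, hm⟩ := Nat.exists_eq_add_of_le' (le_min hk hr)
  refine le_trans ?_ (choose_mul_pow_le_betaFactor (min_le_right k r) x k)
  rw [div_le_iff₀ (by positivity), mul_assoc]
  refine mul_le_mul_of_nonneg_left ?_ (Nat.cast_nonneg _)
  calc x ^ 2 ≤ x ^ 2 * (A * x) ^ (2 * m) :=
        le_mul_of_one_le_right (sq_nonneg x) (one_le_pow₀ hAx)
    _ = x ^ (2 * min k r) * A ^ (2 * m) := by rw [hm]; ring
    _ ≤ x ^ (2 * min k r) * A ^ (2 * (r - 1)) := by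
        have hmr : 2 * m ≤ 2 * (r - 1) := by have := min_le_right k r; omega
        exact mul_le_mul_of_nonneg_left (pow_le_pow_right₀ hA hmr)
          ((even_two_mul _).pow_nonneg x)

lemma rpow_betaFactor_le {r k : ℕ} (hr : 1 ≤ r) (hk : 1 ≤ k) {A x : ℝ} (hA : 1 ≤ A) (hx : 0 < x)
    (hAx : 1 ≤ A * x) {q : ℝ} (hq : 0 ≤ q) :
    betaFactor r x k ^ (-(q / 2)) ≤
      (k.choose (min k r) : ℝ) ^ (-(q / 2)) * ((A ^ (2 * (r - 1))) ^ (q / 2) * x ^ (-q)) := by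
  have hchoose : (0 : ℝ) < k.choose (min k r) :=
    Nat.cast_pos.2 (Nat.choose_pos (min_le_left k r))
  refine (Real.rpow_le_rpow_of_nonpos (by positivity)
    (choose_min_mul_sq_le_betaFactor hr hk hA hAx) (by linarith)).trans_eq ?_
  rw [Real.div_rpow (by positivity) (by positivity), Real.mul_rpow hchoose.le (by positivity),
    Real.rpow_neg (x := A ^ _) (by positivity), div_inv_eq_mul, mul_assoc,
    mul_comm (_ ^ (-(q / 2)) : ℝ) ((A ^ _) ^ _), ← Real.rpow_natCast x, ← Real.rpow_mul hx.le]
  congr 3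
  push_cast
  ring

lemma summable_choose_rpow {s : ℝ} (hs : 0 ≤ s) {r : ℕ} (hr : 1 < r * s) :
    Summable fun k : ℕ => ((k + r).choose r : ℝ) ^ (-s) := by
  have hzeta : Summable fun k : ℕ => (r ! : ℝ) ^ s * (((k + 1 : ℕ) : ℝ) ^ (r * s))⁻¹ :=
    ((summable_nat_add_iff 1).2 (Real.summable_nat_rpow_inv.2 hr)).mul_left _
  refine hzeta.of_nonneg_of_le (fun k => by positivity) fun k => ?_
  have hpow : ((k + 1 : ℕ) : ℝ) ^ r / (r ! : ℝ) ≤ (k + r).choose r := by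
    simpa only [show k + r + 1 - r = k + 1 by omega] using Nat.pow_le_choose (α := ℝ) r (k + r)
  refine (Real.rpow_le_rpow_of_nonpos (by positivity) hpow (by linarith)).trans_eq ?_
  rw [Real.rpow_neg (by positivity), Real.div_rpow (by positivity) (by positivity),
    ← Real.rpow_natCast, ← Real.rpow_mul (Nat.cast_nonneg _), inv_div, div_eq_mul_inv]

lemma summable_choose_min_rpow {s : ℝ} (hs : 0 ≤ s) {r : ℕ} (hr : 1 < r * s) :
    Summable fun k : ℕ => (k.choose (min k r) : ℝ) ^ (-s) := by
  refine (summable_nat_add_iff r).1 ?_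
  simpa only [min_eq_right (Nat.le_add_left r _)] using summable_choose_rpow hs hr

lemma exists_one_le_mul_of_memℓp_inv {ι : Type*} {p : ℝ≥0∞} {ϱ : ι → ℝ} (hϱ : ∀ j, 0 < ϱ j)
    (hϱp : Memℓp (fun j => (ϱ j)⁻¹) p) : ∃ A : ℝ, 1 ≤ A ∧ ∀ j, 1 ≤ A * ϱ j := by
  obtain ⟨A, hA⟩ := (hϱp.of_exponent_ge le_top).bddAbove
  refine ⟨max A 1, le_max_right _ _, fun j => ?_⟩
  rw [← div_le_iff₀ (hϱ j), one_div]
  exact (le_abs_self _).trans ((hA ⟨j, rfl⟩).trans (le_max_left _ _))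

lemma memℓp_rpow_iff_summable {ι : Type*} {q : ℝ} (hq : 0 < q) {b : ι → ℝ} (hb : ∀ i, 0 < b i)
    (t : ℝ) : Memℓp (fun i => b i ^ t) (ENNReal.ofReal q) ↔ Summable fun i => b i ^ (t * q) := by
  rw [memℓp_gen_iff (by rwa [ENNReal.toReal_ofReal hq.le]), ENNReal.toReal_ofReal hq.le]
  refine summable_congr fun i => ?_
  rw [Real.norm_of_nonneg (Real.rpow_nonneg (hb i).le _), ← Real.rpow_mul (hb i).le]

lemma beta_rpow (r : ℕ) (ϱ : ℕ → ℝ) (ν : ℕ →₀ ℕ) (t : ℝ) :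
    beta r ϱ ν ^ t = ν.prod fun j k => betaFactor r (ϱ j) k ^ t :=
  (Real.finsetProd_rpow _ _ (fun _ _ => (betaFactor_pos _ _ _).le) t).symm

lemma memℓp_beta {q : ℝ} (hq : 0 < q) {ϱ : ℕ → ℝ} (hϱ : ∀ j, 0 < ϱ j)
    (hϱq : Memℓp (fun j => (ϱ j)⁻¹) (ENNReal.ofReal q)) {r : ℕ} (hr : 2 / q < (r : ℝ)) :
    Memℓp (fun ν : ℕ →₀ ℕ => beta r ϱ ν ^ (-(1 / 2) : ℝ)) (ENNReal.ofReal q) := by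
  have hr_one : 1 ≤ r := Nat.cast_pos.1 ((by positivity : 0 < 2 / q).trans hr)
  have hrq : 1 < r * (q / 2) := by rw [div_lt_iff₀ hq] at hr; linarith
  obtain ⟨A, hA, hAϱ⟩ := exists_one_le_mul_of_memℓp_inv hϱ hϱq
  have hϱ_sum : Summable fun j => ϱ j ^ (-q) := by
    simp only [← Real.rpow_neg_one] at hϱq
    simpa only [neg_one_mul] using (memℓp_rpow_iff_summable hq hϱ (-1)).1 hϱq
  have hchoose := summable_choose_min_rpow (by positivity : 0 ≤ q / 2) hrq
  rw [memℓp_rpow_iff_summable hq (beta_pos r ϱ), show -(1 / 2) * q = -(q / 2) by ring]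
  simp only [beta_rpow]
  refine summable_finsupp_prod (fun j => by rw [betaFactor_zero, Real.one_rpow])
    (fun j k => Real.rpow_nonneg (betaFactor_pos _ _ _).le _)
    ((hϱ_sum.mul_left ((A ^ (2 * (r - 1))) ^ (q / 2))).mul_left
      (∑' k : ℕ, ((k + 1).choose (min (k + 1) r) : ℝ) ^ (-(q / 2)))) fun j K => ?_
  refine (Finset.sum_le_sum fun k _ =>
    rpow_betaFactor_le hr_one (Nat.le_add_left 1 k) hA (hϱ j) (hAϱ j) hq.le).trans ?_
  rw [← Finset.sum_mul]
  refine mul_le_mul_of_nonneg_right ?_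
    (mul_nonneg (by positivity) (Real.rpow_nonneg (hϱ j).le _))
  exact ((summable_nat_add_iff 1).2 hchoose).sum_le_tsum _ fun k _ => by positivity

lemma memℓp_of_summable_mul_sq {ι : Type*} {q p : ℝ} (hq : 0 < q) (hp : 1 / p = 1 / q + 1 / 2)
    {b v : ι → ℝ} (hb : ∀ i, 0 < b i) (hv : ∀ i, 0 ≤ v i) (hbv : Summable fun i => b i * v i ^ 2)
    (hbq : Memℓp (fun i => b i ^ (-(1 / 2) : ℝ)) (ENNReal.ofReal q)) :
    Memℓp v (ENNReal.ofReal p) := by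
  have hp_pos : 0 < p := one_div_pos.1 (hp ▸ by positivity)
  have hconj : p / q + p / 2 = 1 := by
    rw [← mul_one_div_cancel hp_pos.ne', hp]
    ring
  rw [memℓp_rpow_iff_summable hq hb] at hbq
  rw [memℓp_gen_iff (by rwa [ENNReal.toReal_ofReal hp_pos.le]), ENNReal.toReal_ofReal hp_pos.le]
  -- `v ^ p = (b ^ (-q / 2)) ^ (p / q) * (b * v ^ 2) ^ (p / 2)`, to which AM-GM applies
  refine ((hbq.mul_left (p / q)).add (hbv.mul_left (p / 2))).of_nonneg_of_le
    (fun i => by positivity) fun i => ?_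
  have hbi := (hb i).le
  refine Eq.trans_le ?_ (Real.geom_mean_le_arith_mean2_weighted (by positivity) (by positivity)
    (Real.rpow_nonneg hbi (-(1 / 2) * q)) (mul_nonneg hbi (sq_nonneg (v i))) hconj)
  have hb_exp : -(1 / 2) * q * (p / q) + p / 2 = 0 := by field_simp; ring
  have hv_exp : ((2 : ℕ) : ℝ) * (p / 2) = p := by push_cast; ring
  rw [Real.norm_of_nonneg (hv i), ← Real.rpow_mul hbi, Real.mul_rpow hbi (sq_nonneg _),
    ← mul_assoc, ← Real.rpow_add (hb i), ← Real.rpow_natCast (v i), ← Real.rpow_mul (hv i),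
    hb_exp, hv_exp, Real.rpow_zero, one_mul]

end Beta

section MultiChoose

/-- The multi-index binomial coefficient `(ν choose μ) = ∏_j (ν_j choose μ_j)`. -/
def multiChoose (ν μ : ℕ →₀ ℕ) : ℝ := μ.prod fun j m => ((ν j).choose m : ℝ)

lemma multiChoose_eq_zero {ν μ : ℕ →₀ ℕ} (h : ¬ μ ≤ ν) : multiChoose ν μ = 0 := by
  obtain ⟨i, hi⟩ := not_forall.1 (mt Finsupp.le_def.2 h)
  refine Finset.prod_eq_zero (i := i) (Finsupp.mem_support_iff.2 (by omega)) ?_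
  exact Nat.cast_eq_zero.2 (Nat.choose_eq_zero_of_lt (not_le.1 hi))

lemma multiPow_two_smul (c : ℕ → ℝ) (μ : ℕ →₀ ℕ) :
    multiPow c (2 • μ) = μ.prod fun j m => c j ^ (2 * m) := by
  rw [multiPow, Finsupp.prod_of_support_subset _ Finsupp.support_smul _ fun i _ => pow_zero _]
  rfl

lemma multiPow_two_smul_nonneg (c : ℕ → ℝ) (μ : ℕ →₀ ℕ) : 0 ≤ multiPow c (2 • μ) := by
  rw [multiPow_two_smul]
  exact Finset.prod_nonneg fun j _ => (even_two_mul _).pow_nonneg (c j)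

lemma beta_eq_sum {s : Finset ℕ} {ν : ℕ →₀ ℕ} (hs : ν.support ⊆ s) (r : ℕ) (ϱ : ℕ → ℝ) :
    beta r ϱ ν = ∑ μ ∈ s.finsupp fun _ => Finset.range (r + 1),
      multiPow ϱ (2 • μ) * multiChoose ν μ := by
  rw [beta_eq_prod_betaFactor, Finsupp.prod_of_support_subset _ hs _ fun i _ => betaFactor_zero _ _]
  unfold betaFactor
  rw [← sum_finsupp_prod s (fun _ => Finset.range (r + 1))
      (fun j l => ((ν j).choose l : ℝ) * ϱ j ^ (2 * l)) fun j => by simp]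
  refine Finset.sum_congr rfl fun μ _ => ?_
  rw [multiPow_two_smul, multiChoose, mul_comm, Finsupp.prod_mul]

lemma apply_le_of_mem_finsupp_range {ι : Type*} {s : Finset ι} {r : ℕ}
    {μ : ι →₀ ℕ} (hμ : μ ∈ s.finsupp fun _ => Finset.range (r + 1)) (j : ι) : μ j ≤ r := by
  obtain ⟨hsupp, hrange⟩ := Finset.mem_finsupp_iff.1 hμ
  by_cases hj : j ∈ s
  · exact Nat.lt_succ_iff.1 (Finset.mem_range.1 (hrange j hj))
  · rw [Finsupp.notMem_support_iff.1 fun h => hj (hsupp h)]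
    exact Nat.zero_le _

lemma exists_sum_multiChoose_mul_eq (v : (ℕ →₀ ℕ) → ℝ) (μ : ℕ →₀ ℕ) (T : Finset (ℕ →₀ ℕ)) :
    ∃ T' : Finset (ℕ →₀ ℕ), ∑ ν ∈ T, multiChoose ν μ * v ν =
      ∑ α ∈ T', multiChoose (α + μ) μ * v (α + μ) := by
  classical
  have hinj : Set.InjOn (fun ν => ν - μ) (T.filter fun ν => μ ≤ ν : Finset (ℕ →₀ ℕ)) := by
    intro a ha b hb hab
    exact tsub_left_inj (Finset.mem_filter.1 ha).2 (Finset.mem_filter.1 hb).2 |>.1 hab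
  refine ⟨(T.filter fun ν => μ ≤ ν).image fun ν => ν - μ, ?_⟩
  rw [Finset.sum_image hinj, ← Finset.sum_filter_of_ne (p := fun ν => μ ≤ ν)]
  · refine Finset.sum_congr rfl fun ν hν => ?_
    rw [tsub_add_cancel_of_le (Finset.mem_filter.1 hν).2]
  · intro ν _ hne
    by_contra hle
    exact hne (by rw [multiChoose_eq_zero hle, zero_mul])

lemma summable_beta_mul {r : ℕ} {ϱ : ℕ → ℝ} {v B : (ℕ →₀ ℕ) → ℝ} (hv : ∀ ν, 0 ≤ v ν)
    (hB : ∀ μ : ℕ →₀ ℕ, (∀ j, μ j ≤ r) → ∀ T : Finset (ℕ →₀ ℕ),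
      ∑ α ∈ T, multiChoose (α + μ) μ * v (α + μ) ≤ B μ)
    (hsum : Summable fun μ : {μ : ℕ →₀ ℕ // ∀ j, μ j ≤ r} => multiPow ϱ (2 • μ.1) * B μ.1) :
    Summable fun ν => beta r ϱ ν * v ν := by
  classical
  have hterm (μ : ℕ →₀ ℕ) (hμ : ∀ j, μ j ≤ r) (T : Finset (ℕ →₀ ℕ)) :
      multiPow ϱ (2 • μ) * ∑ ν ∈ T, multiChoose ν μ * v ν ≤ multiPow ϱ (2 • μ) * B μ := by
    obtain ⟨T', hT'⟩ := exists_sum_multiChoose_mul_eq v μ T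
    exact mul_le_mul_of_nonneg_left (hT' ▸ hB μ hμ T') (multiPow_two_smul_nonneg ϱ μ)
  refine summable_of_sum_le (c := ∑' μ : {μ : ℕ →₀ ℕ // ∀ j, μ j ≤ r},
    multiPow ϱ (2 • μ.1) * B μ.1) (fun ν => mul_nonneg (beta_pos _ _ _).le (hv ν)) fun T => ?_
  set s := T.biUnion Finsupp.support
  set M := s.finsupp fun _ => Finset.range (r + 1)
  have hM : ∀ μ ∈ M, ∀ j, μ j ≤ r := fun μ hμ => apply_le_of_mem_finsupp_range hμ
  calc ∑ ν ∈ T, beta r ϱ ν * v ν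
      = ∑ ν ∈ T, ∑ μ ∈ M, multiPow ϱ (2 • μ) * (multiChoose ν μ * v ν) := by
        refine Finset.sum_congr rfl fun ν hν => ?_
        rw [beta_eq_sum (Finset.subset_biUnion_of_mem Finsupp.support hν), Finset.sum_mul]
        simp only [mul_assoc, M, s]
    _ = ∑ μ ∈ M, multiPow ϱ (2 • μ) * ∑ ν ∈ T, multiChoose ν μ * v ν := by
        rw [Finset.sum_comm]
        simp only [Finset.mul_sum]
    _ ≤ ∑ μ ∈ M, multiPow ϱ (2 • μ) * B μ :=
        Finset.sum_le_sum fun μ hμ => hterm μ (hM μ hμ) T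
    _ = ∑ μ ∈ M.subtype (fun μ => ∀ j, μ j ≤ r), multiPow ϱ (2 • μ.1) * B μ.1 := by
        rw [← Finset.sum_subtype_of_mem (fun μ => multiPow ϱ (2 • μ) * B μ) hM]
    _ ≤ _ := hsum.sum_le_tsum _ fun μ _ => by simpa using hterm μ.1 μ.2 ∅

end MultiChoose

section Operators

variable {Ω : Type*} [MeasurableSpace Ω] {m : Measure Ω}

lemma ae_norm_le_norm_of_top {E : Type*} [NormedAddCommGroup E] (f : Lp E ∞ m) :
    ∀ᵐ x ∂m, ‖f x‖ ≤ ‖f‖ := by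
  filter_upwards [ae_le_eLpNormEssSup (f := f) (μ := m)] with x hx
  rw [Lp.norm_def, eLpNorm_exponent_top, ← toReal_enorm]
  exact ENNReal.toReal_mono (eLpNorm_exponent_top (f := f) (μ := m) ▸ Lp.eLpNorm_ne_top f) hx

lemma norm_le_of_ae_norm_le_of_top {E : Type*} [NormedAddCommGroup E] {f : Lp E ∞ m} {C : ℝ}
    (hC : 0 ≤ C) (h : ∀ᵐ x ∂m, ‖f x‖ ≤ C) : ‖f‖ ≤ C := by
  rw [Lp.norm_def, eLpNorm_exponent_top]
  exact ENNReal.toReal_le_of_le_ofReal hC (eLpNormEssSup_le_of_ae_bound h)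

/-- The real part of an essentially bounded function. -/
def reL : Lp ℂ ∞ m →L[ℝ] Lp ℝ ∞ m := Complex.reCLM.compLpL ∞ m

/-- The imaginary part of an essentially bounded function. -/
def imL : Lp ℂ ∞ m →L[ℝ] Lp ℝ ∞ m := Complex.imCLM.compLpL ∞ m

/-- A real essentially bounded function, regarded as a complex one. -/
def toC : Lp ℝ ∞ m →L[ℝ] Lp ℂ ∞ m := Complex.ofRealCLM.compLpL ∞ m

lemma coeFn_reL (b : Lp ℂ ∞ m) : reL b =ᵐ[m] fun x => (b x).re :=
  Complex.reCLM.coeFn_compLpL b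

lemma coeFn_imL (b : Lp ℂ ∞ m) : imL b =ᵐ[m] fun x => (b x).im :=
  Complex.imCLM.coeFn_compLpL b

lemma coeFn_toC (b : Lp ℝ ∞ m) : toC b =ᵐ[m] fun x => (b x : ℂ) :=
  Complex.ofRealCLM.coeFn_compLpL b

lemma norm_reL_le (b : Lp ℂ ∞ m) : ‖reL b‖ ≤ ‖b‖ := by
  have hcomp := Complex.reCLM.norm_compLp_le b
  rwa [Complex.reCLM_norm, one_mul] at hcomp

lemma norm_imL_le (b : Lp ℂ ∞ m) : ‖imL b‖ ≤ ‖b‖ := by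
  have hcomp := Complex.imCLM.norm_compLp_le b
  rwa [Complex.imCLM_norm, one_mul] at hcomp

lemma reL_toC (b : Lp ℝ ∞ m) : reL (toC b) = b := by
  refine Lp.ext ?_
  filter_upwards [coeFn_reL (toC b), coeFn_toC b] with x hre hC
  rw [hre, hC, Complex.ofReal_re]

lemma imL_toC (b : Lp ℝ ∞ m) : imL (toC b) = 0 := by
  refine Lp.ext ?_
  filter_upwards [coeFn_imL (toC b), coeFn_toC b, Lp.coeFn_zero ℝ ∞ m] with x him hC hzero
  rw [him, hC, hzero, Complex.ofReal_im, Pi.zero_apply]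

lemma norm_sq_eq_integral {𝕜 F : Type*} [RCLike 𝕜] [NormedAddCommGroup F] [InnerProductSpace 𝕜 F]
    (h : Lp F 2 m) : ‖h‖ ^ 2 = ∫ x, ‖h x‖ ^ 2 ∂m := by
  rw [← inner_self_eq_norm_sq (𝕜 := 𝕜) h, L2.inner_def, ← integral_re (L2.integrable_inner h h)]
  exact integral_congr_ae (ae_of_all _ fun x => inner_self_eq_norm_sq (h x))

section Multiplication

variable {𝕜 E : Type*} [RCLike 𝕜] [NormedAddCommGroup E] [InnerProductSpace 𝕜 E]

variable (E m) in
/-- Multiplication by an essentially bounded function, as an operator on `L²`. -/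
def mulOp : Lp 𝕜 ∞ m →L[𝕜] (Lp E 2 m →L[𝕜] Lp E 2 m) :=
  (ContinuousLinearMap.lsmul 𝕜 𝕜).holderL m ∞ 2 2

lemma coeFn_mulOp (b : Lp 𝕜 ∞ m) (h : Lp E 2 m) : mulOp m E b h =ᵐ[m] fun x => b x • h x := by
  rw [mulOp, ContinuousLinearMap.holderL_apply_apply]
  exact ContinuousLinearMap.coeFn_holder _ _ _

lemma coeFn_mulOp_pow (b : Lp 𝕜 ∞ m) (h : Lp E 2 m) (n : ℕ) :
    (mulOp m E b ^ n) h =ᵐ[m] fun x => b x ^ n • h x := by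
  induction n with
  | zero => simp
  | succ n ih =>
    rw [pow_succ']
    filter_upwards [coeFn_mulOp b ((mulOp m E b ^ n) h), ih] with x hmul hpow
    rw [mul_apply_eq_comp, hmul, hpow, smul_smul, pow_succ']

lemma coeFn_sum_smul_mulOp_pow (b : Lp 𝕜 ∞ m) (h : Lp E 2 m) (c : ℕ → 𝕜) (s : Finset ℕ) :
    (∑ i ∈ s, c i • (mulOp m E b ^ i) h : Lp E 2 m) =ᵐ[m]
      fun x => (∑ i ∈ s, c i • b x ^ i) • h x := by
  have hterm : ∀ᵐ x ∂m, ∀ i, (c i • (mulOp m E b ^ i) h : Lp E 2 m) x = (c i • b x ^ i) • h x := by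
    refine ae_all_iff.2 fun i => ?_
    filter_upwards [Lp.coeFn_smul (c i) ((mulOp m E b ^ i) h), coeFn_mulOp_pow b h i]
      with x hsmul hpow
    rw [hsmul, Pi.smul_apply, hpow, smul_assoc]
  filter_upwards [Lp.coeFn_finsetSum s fun i => c i • (mulOp m E b ^ i) h, hterm] with x hsum hx
  rw [hsum, Finset.sum_apply, Finset.sum_smul]
  exact Finset.sum_congr rfl fun i _ => hx i

variable [CompleteSpace E]

lemma coeFn_exp_mulOp (b : Lp 𝕜 ∞ m) (h : Lp E 2 m) :
    NormedSpace.exp (mulOp m E b) h =ᵐ[m] fun x => NormedSpace.exp (b x) • h x := by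
  have hseries := ((NormedSpace.exp_series_hasSum_exp' (𝕂 := 𝕜) (mulOp m E b)).mapL
    (ContinuousLinearMap.apply 𝕜 (Lp E 2 m) h)).tendsto_sum_nat
  obtain ⟨ns, hns, hae⟩ := (tendstoInMeasure_of_tendsto_Lp hseries).exists_seq_tendsto_ae
  have hpartial := ae_all_iff.2 fun n =>
    coeFn_sum_smul_mulOp_pow b h (fun i => (i !⁻¹ : 𝕜)) (Finset.range n)
  filter_upwards [hae, hpartial] with x hx hsum
  have hexp := ((NormedSpace.exp_series_hasSum_exp' (𝕂 := 𝕜) (b x)).tendsto_sum_nat.comp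
    hns.tendsto_atTop).smul_const (h x)
  exact tendsto_nhds_unique hx (hexp.congr fun i => (hsum (ns i)).symm)

lemma mul_norm_sq_le_re_inner_exp_mulOp {c : ℝ} {b : Lp 𝕜 ∞ m}
    (hc : ∀ᵐ x ∂m, c ≤ RCLike.re (NormedSpace.exp (b x))) (h : Lp E 2 m) :
    c * ‖h‖ ^ 2 ≤ RCLike.re (inner 𝕜 (NormedSpace.exp (mulOp m E b) h) h) := by
  have hint : Integrable (fun x => ‖h x‖ ^ 2) m := (Lp.memLp h).norm.integrable_sq
  rw [norm_sq_eq_integral (𝕜 := 𝕜), L2.inner_def, ← integral_re (L2.integrable_inner _ _),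
    ← integral_const_mul]
  refine integral_mono_ae (hint.const_mul _) (L2.integrable_inner _ _).re ?_
  filter_upwards [hc, coeFn_exp_mulOp b h] with x hcx hexp
  rw [hexp, inner_smul_left, inner_self_eq_norm_sq_to_K, ← RCLike.ofReal_pow,
    RCLike.re_mul_ofReal, RCLike.conj_re]
  exact mul_le_mul_of_nonneg_right hcx (sq_nonneg _)

end Multiplication

/-- The coercivity constant of `exp b` provided by
`Re (exp b) = exp (Re b) cos (Im b) ≥ exp (-‖Re b‖) cos ‖Im b‖`. -/
def ellipticity (b : Lp ℂ ∞ m) : ℝ := Real.exp (-‖reL b‖) * Real.cos ‖imL b‖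

lemma cos_norm_pos {V : Type*} [SeminormedAddCommGroup V] {v : V} (hv : ‖v‖ < Real.pi / 2) :
    0 < Real.cos ‖v‖ :=
  Real.cos_pos_of_mem_Ioo ⟨by linarith [norm_nonneg v, Real.pi_pos], hv⟩

lemma ellipticity_pos {b : Lp ℂ ∞ m} (hb : ‖imL b‖ < Real.pi / 2) : 0 < ellipticity b :=
  mul_pos (Real.exp_pos _) (cos_norm_pos hb)

lemma ellipticity_le_re_exp {b : Lp ℂ ∞ m} (hb : ‖imL b‖ < Real.pi / 2) :
    ∀ᵐ x ∂m, ellipticity b ≤ RCLike.re (NormedSpace.exp (b x)) := by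
  filter_upwards [coeFn_imL b, coeFn_reL b, ae_norm_le_norm_of_top (imL b),
    ae_norm_le_norm_of_top (reL b)] with x him hre him_le hre_le
  rw [him, Real.norm_eq_abs] at him_le
  rw [hre, Real.norm_eq_abs] at hre_le
  rw [← Complex.exp_eq_exp_ℂ, RCLike.re_eq_complex_re, Complex.exp_re]
  refine mul_le_mul (Real.exp_le_exp.2 ?_) ?_ (cos_norm_pos hb).le (Real.exp_pos _).le
  · linarith [neg_abs_le (b x).re]
  · rw [← Real.cos_abs (b x).im]
    exact Real.cos_le_cos_of_nonneg_of_le_pi (abs_nonneg _) (by linarith [Real.pi_pos]) him_le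

lemma mul_norm_le_of_mul_norm_sq_le_re_inner {𝕜 F : Type*} [RCLike 𝕜] [NormedAddCommGroup F]
    [InnerProductSpace 𝕜 F] {c : ℝ} {g g' : F} (h : c * ‖g‖ ^ 2 ≤ RCLike.re (inner 𝕜 g' g)) :
    c * ‖g‖ ≤ ‖g'‖ := by
  rcases (norm_nonneg g).eq_or_lt with hzero | hpos
  · rw [← hzero, mul_zero]
    exact norm_nonneg _
  · refine le_of_mul_le_mul_right ?_ hpos
    calc c * ‖g‖ * ‖g‖ = c * ‖g‖ ^ 2 := by ring
      _ ≤ ‖g'‖ * ‖g‖ := h.trans ((RCLike.re_le_norm _).trans (norm_inner_le_norm g' g))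

lemma analyticAt_compression {𝕜 A H L : Type*} [NontriviallyNormedField 𝕜] [NormedAddCommGroup A]
    [NormedSpace 𝕜 A] [NormedAddCommGroup H] [NormedSpace 𝕜 H] [NormedAddCommGroup L]
    [NormedSpace 𝕜 L] (P : H →L[𝕜] L) (J : L →L[𝕜] H) {T : A → H →L[𝕜] H} {b : A}
    (hT : AnalyticAt 𝕜 T b) : AnalyticAt 𝕜 (fun b => P ∘L T b ∘L J) b :=
  AnalyticAt.comp (g := (ContinuousLinearMap.compL 𝕜 L H L P).comp
    ((ContinuousLinearMap.compL 𝕜 L H H).flip J)) (ContinuousLinearMap.analyticAt _ _) hT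

variable {E : Type*} [NormedAddCommGroup E] [InnerProductSpace ℂ E] [CompleteSpace E]
  (K : Submodule ℂ (Lp E 2 m)) [CompleteSpace K]

/-- The compression to the subspace `K` of the multiplication by `exp b`: the operator on `K`
representing the sesquilinear form `(g, k) ↦ ∫ exp(b) g · k`. -/
def formOp (b : Lp ℂ ∞ m) : K →L[ℂ] K :=
  K.orthogonalProjectionOnto ∘L (NormedSpace.exp (mulOp m E b)) ∘L K.subtypeL

lemma inner_formOp (b : Lp ℂ ∞ m) (g k : K) :
    inner ℂ (formOp K b g) k =
      inner ℂ (NormedSpace.exp (mulOp m E b) (g : Lp E 2 m)) (k : Lp E 2 m) := by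
  simp [formOp]

lemma ellipticity_mul_norm_sq_le_re_inner_formOp {b : Lp ℂ ∞ m} (hb : ‖imL b‖ < Real.pi / 2)
    (g : K) : ellipticity b * ‖g‖ ^ 2 ≤ RCLike.re (inner ℂ (formOp K b g) g) :=
  inner_formOp K b g g ▸ mul_norm_sq_le_re_inner_exp_mulOp (ellipticity_le_re_exp hb) (g : Lp E 2 m)

lemma isUnit_formOp {b : Lp ℂ ∞ m} (hb : ‖imL b‖ < Real.pi / 2) : IsUnit (formOp K b) := by
  refine ContinuousLinearMap.isUnit_of_forall_le_norm_inner_map _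
    (c := ⟨ellipticity b, (ellipticity_pos hb).le⟩) (ellipticity_pos hb) fun g => ?_
  rw [mul_comm]
  exact (ellipticity_mul_norm_sq_le_re_inner_formOp K hb g).trans (RCLike.re_le_norm _)

lemma analyticAt_formOp (b : Lp ℂ ∞ m) : AnalyticAt ℂ (formOp K) b :=
  analyticAt_compression _ _
    ((NormedSpace.exp_analytic (𝕂 := ℂ) (mulOp m E b)).comp ((mulOp (𝕜 := ℂ) m E).analyticAt b))

/-- The solution `g ∈ K` of `formOp K b g = F`; it is junk where `formOp K b` is not invertible. -/
def solveOp (F : K) (b : Lp ℂ ∞ m) : K := Ring.inverse (formOp K b) F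

lemma formOp_eq_iff_eq_solveOp {F g : K} {b : Lp ℂ ∞ m} (hb : ‖imL b‖ < Real.pi / 2) :
    formOp K b g = F ↔ g = solveOp K F b := by
  constructor
  · rintro rfl
    exact (congrArg (fun A : K →L[ℂ] K => A g)
      (Ring.inverse_mul_cancel _ (isUnit_formOp K hb))).symm
  · rintro rfl
    exact congrArg (fun A : K →L[ℂ] K => A F) (Ring.mul_inverse_cancel _ (isUnit_formOp K hb))

lemma analyticAt_solveOp (F : K) {b : Lp ℂ ∞ m} (hb : ‖imL b‖ < Real.pi / 2) :
    AnalyticAt ℂ (solveOp K F) b := by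
  obtain ⟨A, hA⟩ := isUnit_formOp K hb
  have hinverse : AnalyticAt ℂ Ring.inverse (formOp K b) :=
    hA ▸ analyticAt_inverse (𝕜 := ℂ) (A := K →L[ℂ] K) A
  exact ((ContinuousLinearMap.apply ℂ K F).analyticAt _).comp
    (hinverse.comp (analyticAt_formOp K b))

lemma norm_solveOp_le (F : K) {b : Lp ℂ ∞ m} (hb : ‖imL b‖ < Real.pi / 2) :
    ‖solveOp K F b‖ ≤ ‖F‖ / Real.cos ‖imL b‖ * Real.exp ‖reL b‖ := by
  have hcoercive := mul_norm_le_of_mul_norm_sq_le_re_inner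
    (ellipticity_mul_norm_sq_le_re_inner_formOp K hb (solveOp K F b))
  rw [(formOp_eq_iff_eq_solveOp K hb).2 rfl, mul_comm, ← le_div_iff₀ (ellipticity_pos hb)]
    at hcoercive
  refine hcoercive.trans_eq ?_
  rw [ellipticity, Real.exp_neg]
  field_simp

end Operators

section DirectionalDerivatives

variable {A X : Type*} [NormedAddCommGroup A] [NormedSpace ℂ A] [NormedAddCommGroup X]
  [NormedSpace ℂ X]

/-- The derivative of `G` in the direction `ψ`, as a function of the point `b`. -/
def dirDeriv (ψ : A) (G : A → X) (b : A) : X := fderiv ℂ G b ψ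

lemma hasDerivAt_line {G : A → X} {b ψ : A} {ζ : ℂ} (hG : DifferentiableAt ℂ G (b + ζ • ψ)) :
    HasDerivAt (fun ζ : ℂ => G (b + ζ • ψ)) (dirDeriv ψ G (b + ζ • ψ)) ζ := by
  have hline : HasDerivAt (fun ζ : ℂ => b + ζ • ψ) ((1 : ℂ) • ψ) ζ :=
    ((hasDerivAt_id ζ).smul_const ψ).const_add b
  rw [one_smul] at hline
  exact hG.hasFDerivAt.comp_hasDerivAt ζ hline

lemma hasDerivAt_real_line {G : A → X} {b ψ : A} {a t : ℝ}
    (hG : DifferentiableAt ℂ G (b + ((t - a : ℝ) : ℂ) • ψ)) :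
    HasDerivAt (fun t : ℝ => G (b + ((t - a : ℝ) : ℂ) • ψ))
      (dirDeriv ψ G (b + ((t - a : ℝ) : ℂ) • ψ)) t := by
  have hscalar : HasDerivAt (fun t : ℝ => ((t - a : ℝ) : ℂ)) 1 t :=
    ((hasDerivAt_id t).sub_const a).ofReal_comp
  simpa only [one_smul, Function.comp_def] using (hasDerivAt_line hG).scomp t hscalar

variable [CompleteSpace X] {G : A → X} {S : Set A}

lemma analyticOnNhd_dirDeriv (hG : AnalyticOnNhd ℂ G S) (ψ : A) :
    AnalyticOnNhd ℂ (dirDeriv ψ G) S := fun b hb =>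
  ((ContinuousLinearMap.apply ℂ X ψ).analyticAt _).comp (hG b hb).fderiv

lemma analyticOnNhd_iterate_dirDeriv (hG : AnalyticOnNhd ℂ G S) (ψ : A) (k : ℕ) :
    AnalyticOnNhd ℂ ((dirDeriv ψ)^[k] G) S := by
  induction k with
  | zero => exact hG
  | succ k ih =>
    rw [Function.iterate_succ_apply']
    exact analyticOnNhd_dirDeriv ih ψ

lemma iteratedDeriv_line (hS : IsOpen S) (hG : AnalyticOnNhd ℂ G S) (b ψ : A) (k : ℕ) {ζ : ℂ}
    (hζ : b + ζ • ψ ∈ S) :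
    iteratedDeriv k (fun ζ : ℂ => G (b + ζ • ψ)) ζ = (dirDeriv ψ)^[k] G (b + ζ • ψ) := by
  induction k generalizing ζ with
  | zero => rw [iteratedDeriv_zero, Function.iterate_zero, id_eq]
  | succ k ih =>
    have hopen : IsOpen {ζ : ℂ | b + ζ • ψ ∈ S} := hS.preimage (by fun_prop)
    have hev : iteratedDeriv k (fun ζ : ℂ => G (b + ζ • ψ)) =ᶠ[𝓝 ζ]
        fun ζ => (dirDeriv ψ)^[k] G (b + ζ • ψ) :=
      Filter.mem_of_superset (hopen.mem_nhds hζ) fun z hz => ih hz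
    rw [iteratedDeriv_succ, hev.deriv_eq, Function.iterate_succ_apply']
    exact (hasDerivAt_line (analyticOnNhd_iterate_dirDeriv hG ψ k _ hζ).differentiableAt).deriv

lemma norm_iterate_dirDeriv_le (hS : IsOpen S) (hG : AnalyticOnNhd ℂ G S) {b ψ : A} {k : ℕ}
    {R C : ℝ} (hR : 0 ≤ R) (hkR : k ≠ 0 → R ≠ 0)
    (hb : ∀ ζ : ℂ, ‖ζ‖ ≤ R → b + ζ • ψ ∈ S ∧ ‖G (b + ζ • ψ)‖ ≤ C) :
    ‖(dirDeriv ψ)^[k] G b‖ ≤ (k ! : ℝ) / R ^ k * C := by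
  have hcenter : b + (0 : ℂ) • ψ ∈ S ∧ ‖G (b + (0 : ℂ) • ψ)‖ ≤ C := hb 0 (by rwa [norm_zero])
  rcases eq_or_ne k 0 with rfl | hk
  · simpa using hcenter.2
  · have hRpos : 0 < R := hR.lt_of_ne' (hkR hk)
    have hdiff : DiffContOnCl ℂ (fun ζ : ℂ => G (b + ζ • ψ)) (Metric.ball 0 R) := by
      refine DifferentiableOn.diffContOnCl fun ζ hζ => ?_
      rw [closure_ball _ hRpos.ne', mem_closedBall_zero_iff] at hζ
      exact (hasDerivAt_line
        (hG _ (hb ζ hζ).1).differentiableAt).differentiableAt.differentiableWithinAt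
    have hcauchy := Complex.norm_iteratedDeriv_le_of_forall_mem_sphere_norm_le k hRpos hdiff
      fun ζ hζ => (hb ζ (mem_sphere_zero_iff_norm.1 hζ).le).2
    rw [iteratedDeriv_line hS hG b ψ k hcenter.1, zero_smul, add_zero] at hcauchy
    exact hcauchy.trans_eq (by ring)

/-- The mixed derivative `∂^μ G` in the directions `ψ 0, …, ψ (n - 1)`. -/
def mixedDeriv (ψ : ℕ → A) (μ : ℕ → ℕ) (G : A → X) : ℕ → A → X
  | 0 => G
  | n + 1 => (dirDeriv (ψ n))^[μ n] (mixedDeriv ψ μ G n)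

lemma analyticOnNhd_mixedDeriv (hG : AnalyticOnNhd ℂ G S) (ψ : ℕ → A) (μ : ℕ → ℕ) (n : ℕ) :
    AnalyticOnNhd ℂ (mixedDeriv ψ μ G n) S := by
  induction n with
  | zero => exact hG
  | succ n ih => exact analyticOnNhd_iterate_dirDeriv ih (ψ n) (μ n)

lemma add_sum_update_smul (b : A) (ψ : ℕ → A) (z : ℕ → ℂ) (n : ℕ) (ζ : ℂ) :
    b + ∑ j ∈ Finset.range (n + 1), Function.update z n ζ j • ψ j =
      b + ζ • ψ n + ∑ j ∈ Finset.range n, z j • ψ j := by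
  have hsum : ∑ j ∈ Finset.range n, Function.update z n ζ j • ψ j =
      ∑ j ∈ Finset.range n, z j • ψ j :=
    Finset.sum_congr rfl fun j hj => by rw [Function.update_of_ne (Finset.mem_range.1 hj).ne]
  rw [Finset.sum_range_succ, Function.update_self, hsum, add_assoc, add_comm (ζ • ψ n)]

lemma norm_mixedDeriv_le (hS : IsOpen S) (hG : AnalyticOnNhd ℂ G S) (ψ : ℕ → A) (μ : ℕ → ℕ)
    {R : ℕ → ℝ} (hR : ∀ j, 0 ≤ R j) (hμR : ∀ j, μ j ≠ 0 → R j ≠ 0) {C : ℝ} (n : ℕ) (b : A)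
    (hb : ∀ z : ℕ → ℂ, (∀ j, ‖z j‖ ≤ R j) →
      b + ∑ j ∈ Finset.range n, z j • ψ j ∈ S ∧
        ‖G (b + ∑ j ∈ Finset.range n, z j • ψ j)‖ ≤ C) :
    ‖mixedDeriv ψ μ G n b‖ ≤ (∏ j ∈ Finset.range n, ((μ j)! : ℝ) / R j ^ μ j) * C := by
  have hzero : ∀ j, ‖(0 : ℂ)‖ ≤ R j := fun j => by rw [norm_zero]; exact hR j
  induction n generalizing b with
  | zero => simpa [mixedDeriv] using (hb (fun _ => 0) hzero).2
  | succ n ih =>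
    rw [Finset.prod_range_succ, mul_comm (∏ j ∈ Finset.range n, _), mul_assoc]
    refine norm_iterate_dirDeriv_le hS (analyticOnNhd_mixedDeriv hG ψ μ n) (hR n) (hμR n)
      fun ζ hζ => ?_
    have hslice : ∀ z : ℕ → ℂ, (∀ j, ‖z j‖ ≤ R j) →
        b + ζ • ψ n + ∑ j ∈ Finset.range n, z j • ψ j ∈ S ∧
          ‖G (b + ζ • ψ n + ∑ j ∈ Finset.range n, z j • ψ j)‖ ≤ C := by
      intro z hz
      rw [← add_sum_update_smul]
      refine hb _ fun j => ?_
      rcases eq_or_ne j n with rfl | hj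
      · rwa [Function.update_self]
      · rw [Function.update_of_ne hj]
        exact hz j
    exact ⟨by simpa using (hslice (fun _ => 0) hzero).1, ih _ hslice⟩

end DirectionalDerivatives

section Strip

variable {Ω : Type*} [MeasurableSpace Ω] {m : Measure Ω}

variable (m) in
/-- The complex coefficients `b` with `‖Im b‖ < π / 2`; for these `Re (exp b)` is bounded from below
by a positive constant. -/
def strip : Set (Lp ℂ ∞ m) := {b | ‖imL b‖ < Real.pi / 2}

lemma isOpen_strip : IsOpen (strip m) :=
  isOpen_lt imL.continuous.norm continuous_const

lemma toC_mem_strip (b : Lp ℝ ∞ m) : toC b ∈ strip m := by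
  refine lt_of_eq_of_lt ?_ Real.pi_div_two_pos
  rw [imL_toC, norm_zero]

lemma norm_imL_add_smul_le (b ψ : Lp ℂ ∞ m) (ζ : ℂ) :
    ‖imL (b + ζ • ψ)‖ ≤ ‖imL b‖ + ‖ζ‖ * ‖ψ‖ := by
  rw [map_add, ← norm_smul]
  exact (norm_add_le _ _).trans (add_le_add_right (norm_imL_le _) _)

lemma norm_reL_add_smul_le (b ψ : Lp ℂ ∞ m) (ζ : ℂ) :
    ‖reL (b + ζ • ψ)‖ ≤ ‖reL b‖ + ‖ζ‖ * ‖ψ‖ := by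
  rw [map_add, ← norm_smul]
  exact (norm_add_le _ _).trans (add_le_add_right (norm_reL_le _) _)

variable {X : Type*} [NormedAddCommGroup X] [NormedSpace ℂ X]

/-- Holomorphy of `G` on the strip `‖Im b‖ < π / 2`, with growth at most `exp ‖Re b‖` on every
smaller closed strip. The class is closed under directional derivatives. -/
structure IsStripHolomorphic (G : Lp ℂ ∞ m → X) : Prop where
  analyticOnNhd : AnalyticOnNhd ℂ G (strip m)
  growth : ∀ s < Real.pi / 2, ∃ C, 0 ≤ C ∧ ∀ b, ‖imL b‖ ≤ s → ‖G b‖ ≤ C * Real.exp ‖reL b‖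

lemma isStripHolomorphic_solveOp {E : Type*} [NormedAddCommGroup E] [InnerProductSpace ℂ E]
    [CompleteSpace E] (K : Submodule ℂ (Lp E 2 m)) [CompleteSpace K] (F : K) :
    IsStripHolomorphic (solveOp K F) where
  analyticOnNhd _ hb := analyticAt_solveOp K F hb
  growth s hs := by
    rcases lt_or_ge s 0 with hneg | hs0
    · exact ⟨0, le_rfl, fun b hb => absurd ((norm_nonneg _).trans hb) hneg.not_ge⟩
    · have hcos : 0 < Real.cos s := Real.cos_pos_of_mem_Ioo ⟨by linarith [Real.pi_pos], hs⟩
      refine ⟨‖F‖ / Real.cos s, by positivity, fun b hb => ?_⟩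
      refine (norm_solveOp_le K F (hb.trans_lt hs)).trans ?_
      gcongr
      exact Real.cos_le_cos_of_nonneg_of_le_pi (norm_nonneg _) (by linarith [Real.pi_pos]) hb

variable [CompleteSpace X] {G : Lp ℂ ∞ m → X}

lemma IsStripHolomorphic.dirDeriv (hG : IsStripHolomorphic G) (ψ : Lp ℂ ∞ m) :
    IsStripHolomorphic (dirDeriv ψ G) where
  analyticOnNhd := analyticOnNhd_dirDeriv hG.analyticOnNhd ψ
  growth s hs := by
    obtain ⟨s', hss', hs'⟩ := exists_between hs
    obtain ⟨C, hC0, hC⟩ := hG.growth s' hs'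
    obtain ⟨R, hR, hRψ⟩ := exists_pos_mul_lt (sub_pos.2 hss') ‖ψ‖
    refine ⟨C * Real.exp (R * ‖ψ‖) / R, by positivity, fun b hb => ?_⟩
    have hcauchy : ‖(LogGaussian.dirDeriv ψ)^[1] G b‖ ≤
        (1 ! : ℝ) / R ^ 1 * (C * Real.exp (‖reL b‖ + R * ‖ψ‖)) := by
      refine norm_iterate_dirDeriv_le isOpen_strip hG.analyticOnNhd hR.le (fun _ => hR.ne')
        fun ζ hζ => ?_
      have hζψ : ‖ζ‖ * ‖ψ‖ ≤ R * ‖ψ‖ := mul_le_mul_of_nonneg_right hζ (norm_nonneg ψ)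
      have him : ‖imL (b + ζ • ψ)‖ ≤ s' := by linarith [norm_imL_add_smul_le b ψ ζ]
      refine ⟨him.trans_lt hs', (hC _ him).trans ?_⟩
      gcongr
      linarith [norm_reL_add_smul_le b ψ ζ]
    refine hcauchy.trans_eq ?_
    rw [Nat.factorial_one, Nat.cast_one, pow_one, Real.exp_add]
    ring

lemma IsStripHolomorphic.iterate_dirDeriv (hG : IsStripHolomorphic G) (ψ : Lp ℂ ∞ m) (k : ℕ) :
    IsStripHolomorphic ((LogGaussian.dirDeriv ψ)^[k] G) := by
  induction k with
  | zero => exact hG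
  | succ k ih =>
    rw [Function.iterate_succ_apply']
    exact ih.dirDeriv ψ

lemma IsStripHolomorphic.mixedDeriv (hG : IsStripHolomorphic G) (ψ : ℕ → Lp ℂ ∞ m) (μ : ℕ → ℕ)
    (n : ℕ) : IsStripHolomorphic (mixedDeriv ψ μ G n) := by
  induction n with
  | zero => exact hG
  | succ n ih => exact ih.iterate_dirDeriv (ψ n) (μ n)

end Strip

section GaussianCoefficient

variable {Ω : Type*} [MeasurableSpace Ω] {m : Measure Ω}

/-- An affine random coefficient `b` with directions `ψ j` (the paper's `b(y) = ∑ y_j ψ_j`), having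
square integrable exponential moments. -/
structure IsGaussianCoeff (ψ : ℕ → Lp ℝ ∞ m) (b : (ℕ → ℝ) → Lp ℝ ∞ m) : Prop where
  aestronglyMeasurable : AEStronglyMeasurable b gaussian
  integrable_exp : Integrable (fun y => Real.exp ‖b y‖ ^ 2) gaussian
  update : ∀ᵐ y ∂gaussian, ∀ j t, b (Function.update y j t) = b y + (t - y j) • ψ j

variable {ψ : ℕ → Lp ℝ ∞ m} {b : (ℕ → ℝ) → Lp ℝ ∞ m}

lemma IsGaussianCoeff.memLp_exp (hb : IsGaussianCoeff ψ b) :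
    MemLp (fun y => Real.exp ‖b y‖) 2 gaussian :=
  (memLp_two_iff_integrable_sq
    (Real.continuous_exp.comp_aestronglyMeasurable hb.aestronglyMeasurable.norm)).2
    hb.integrable_exp

lemma IsGaussianCoeff.integral_norm_sq_le {X : Type*} [NormedAddCommGroup X] {M : (ℕ → ℝ) → X}
    (hb : IsGaussianCoeff ψ b) (hM : MemLp M 2 gaussian) {c : ℝ}
    (hbound : ∀ y, ‖M y‖ ≤ c * Real.exp ‖b y‖) :
    ∫ y, ‖M y‖ ^ 2 ∂gaussian ≤ c ^ 2 * ∫ y, Real.exp ‖b y‖ ^ 2 ∂gaussian := by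
  rw [← integral_const_mul]
  refine integral_mono hM.norm.integrable_sq (hb.integrable_exp.const_mul _) fun y => ?_
  exact (pow_le_pow_left₀ (norm_nonneg _) (hbound y) 2).trans_eq (mul_pow _ _ 2)

lemma toC_smul (c : ℝ) (a : Lp ℝ ∞ m) : toC (c • a) = (c : ℂ) • toC a := by
  refine Lp.ext ?_
  filter_upwards [coeFn_toC (c • a), Lp.coeFn_smul c a, Lp.coeFn_smul (c : ℂ) (toC a),
    coeFn_toC a] with x hca hsmul hsmulC ha
  rw [hca, hsmul, hsmulC, Pi.smul_apply, Pi.smul_apply, ha, smul_eq_mul, smul_eq_mul,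
    Complex.ofReal_mul]

lemma norm_sum_smul_toC_le {ι : Type*} {ψ : ι → Lp ℝ ∞ m} {R : ι → ℝ} {z : ι → ℂ}
    {s : Finset ι} {κ : ℝ} (hκ0 : 0 ≤ κ) (hκ : ∀ᵐ x ∂m, ∑ j ∈ s, R j * |ψ j x| ≤ κ)
    (hz : ∀ j, ‖z j‖ ≤ R j) : ‖∑ j ∈ s, z j • toC (ψ j)‖ ≤ κ := by
  have hterm : ∀ᵐ x ∂m, ∀ j ∈ s, (z j • toC (ψ j)) x = z j * (ψ j x : ℂ) := by
    refine (Finset.eventually_all s).2 fun j _ => ?_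
    filter_upwards [Lp.coeFn_smul (z j) (toC (ψ j)), coeFn_toC (ψ j)] with x hsmul hC
    rw [hsmul, Pi.smul_apply, hC, smul_eq_mul]
  refine norm_le_of_ae_norm_le_of_top hκ0 ?_
  filter_upwards [Lp.coeFn_finsetSum s fun j => z j • toC (ψ j), hterm, hκ] with x hsum hx hκx
  rw [hsum, Finset.sum_apply]
  refine (norm_sum_le _ _).trans ((Finset.sum_le_sum fun j hj => ?_).trans hκx)
  rw [hx j hj, norm_mul, Complex.norm_real, Real.norm_eq_abs]
  exact mul_le_mul_of_nonneg_right (hz j) (abs_nonneg _)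

variable {X : Type*} [NormedAddCommGroup X] [NormedSpace ℂ X] {G : Lp ℂ ∞ m → X}

lemma IsStripHolomorphic.continuous_comp_toC (hG : IsStripHolomorphic G) :
    Continuous fun a : Lp ℝ ∞ m => G (toC a) :=
  continuous_iff_continuousAt.2 fun a =>
    ContinuousAt.comp (g := G) (hG.analyticOnNhd _ (toC_mem_strip a)).continuousAt
      toC.continuous.continuousAt

lemma IsGaussianCoeff.memLp_comp (hb : IsGaussianCoeff ψ b) (hG : IsStripHolomorphic G) :
    MemLp (fun y => G (toC (b y))) 2 gaussian := by
  obtain ⟨C, -, hC⟩ := hG.growth 0 Real.pi_div_two_pos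
  refine (hb.memLp_exp.const_mul C).mono
    (hG.continuous_comp_toC.comp_aestronglyMeasurable hb.aestronglyMeasurable)
    (ae_of_all _ fun y => ?_)
  have hgrowth := hC (toC (b y)) (by rw [imL_toC, norm_zero])
  rw [reL_toC] at hgrowth
  exact hgrowth.trans (le_abs_self _)

variable [CompleteSpace X]

lemma IsGaussianCoeff.hermiteCoeff_dirDeriv (hb : IsGaussianCoeff ψ b)
    (hG : IsStripHolomorphic G) (j : ℕ) (α : ℕ →₀ ℕ) :
    hermiteCoeff (fun y => dirDeriv (toC (ψ j)) G (toC (b y))) α =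
      √((α j : ℝ) + 1) • hermiteCoeff (fun y => G (toC (b y))) (α + Finsupp.single j 1) := by
  refine hermiteCoeff_deriv (hb.memLp_comp hG) (hb.memLp_comp (hG.dirDeriv _)) j ?_ α
  filter_upwards [hb.update] with y hy t
  have hline : ∀ t, toC (b (Function.update y j t)) =
      toC (b y) + ((t - y j : ℝ) : ℂ) • toC (ψ j) := fun t => by
    rw [hy, map_add, toC_smul]
  simp only [hline]
  refine hasDerivAt_real_line (hG.analyticOnNhd _ ?_).differentiableAt
  exact hline t ▸ toC_mem_strip _

lemma IsGaussianCoeff.norm_hermiteCoeff_iterate_dirDeriv_sq (hb : IsGaussianCoeff ψ b)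
    (hG : IsStripHolomorphic G) (j k : ℕ) (α : ℕ →₀ ℕ) :
    ‖hermiteCoeff (fun y => (dirDeriv (toC (ψ j)))^[k] G (toC (b y))) α‖ ^ 2 =
      ((α j + 1).ascFactorial k : ℝ) *
        ‖hermiteCoeff (fun y => G (toC (b y))) (α + Finsupp.single j k)‖ ^ 2 := by
  induction k generalizing α with
  | zero => simp
  | succ k ih =>
    have hfactorial : ((α j : ℝ) + 1) * ((α j + 1 + 1).ascFactorial k : ℝ) =
        ((α j + 1).ascFactorial (k + 1) : ℝ) := by
      exact_mod_cast Nat.succ_ascFactorial (α j + 1) k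
    rw [Function.iterate_succ_apply', hb.hermiteCoeff_dirDeriv (hG.iterate_dirDeriv _ k),
      norm_smul, mul_pow, ih, Real.norm_of_nonneg (Real.sqrt_nonneg _),
      Real.sq_sqrt (by positivity), add_assoc, ← Finsupp.single_add, add_comm 1 k, ← mul_assoc,
      Finsupp.add_apply, Finsupp.single_eq_same, hfactorial]

lemma IsGaussianCoeff.norm_hermiteCoeff_mixedDeriv_sq (hb : IsGaussianCoeff ψ b)
    (hG : IsStripHolomorphic G) (μ : ℕ → ℕ) (n : ℕ) (α : ℕ →₀ ℕ) :
    ‖hermiteCoeff (fun y => mixedDeriv (fun j => toC (ψ j)) μ G n (toC (b y))) α‖ ^ 2 =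
      (∏ j ∈ Finset.range n, ((α j + 1).ascFactorial (μ j) : ℝ)) *
        ‖hermiteCoeff (fun y => G (toC (b y)))
          (α + ∑ j ∈ Finset.range n, Finsupp.single j (μ j))‖ ^ 2 := by
  induction n generalizing α with
  | zero => simp [mixedDeriv]
  | succ n ih =>
    have hprod : ∏ j ∈ Finset.range n,
          (((α + Finsupp.single n (μ n)) j + 1).ascFactorial (μ j) : ℝ) =
        ∏ j ∈ Finset.range n, ((α j + 1).ascFactorial (μ j) : ℝ) :=
      Finset.prod_congr rfl fun j hj => by
        rw [Finsupp.add_apply, Finsupp.single_eq_of_ne (Finset.mem_range.1 hj).ne, add_zero]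
    refine (hb.norm_hermiteCoeff_iterate_dirDeriv_sq
      (hG.mixedDeriv (fun j => toC (ψ j)) μ n) n (μ n) α).trans ?_
    rw [ih, hprod, Finset.prod_range_succ, Finset.sum_range_succ, add_assoc,
      add_comm (Finsupp.single n (μ n)), mul_left_comm, mul_assoc, mul_left_comm]

lemma multiFactorial_pos (μ : ℕ →₀ ℕ) : 0 < multiFactorial μ :=
  Finset.prod_pos fun j _ => Nat.cast_pos.2 (μ j).factorial_pos

lemma multiPow_two_smul_eq_sq (c : ℕ → ℝ) (μ : ℕ →₀ ℕ) :
    multiPow c (2 • μ) = multiPow c μ ^ 2 := by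
  rw [multiPow_two_smul, multiPow, Finsupp.prod, Finsupp.prod, ← Finset.prod_pow]
  exact Finset.prod_congr rfl fun j _ => by rw [← pow_mul, mul_comm]

lemma prod_ascFactorial_eq {s : Finset ℕ} {μ : ℕ →₀ ℕ} (hs : μ.support ⊆ s) (α : ℕ →₀ ℕ) :
    ∏ j ∈ s, ((α j + 1).ascFactorial (μ j) : ℝ) = multiFactorial μ * multiChoose (α + μ) μ := by
  rw [multiFactorial, multiChoose, Finsupp.prod_of_support_subset _ hs _ fun _ _ => by simp,
    Finsupp.prod_of_support_subset _ hs _ fun _ _ => by simp, ← Finset.prod_mul_distrib]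
  refine Finset.prod_congr rfl fun j _ => ?_
  rw [Nat.ascFactorial_eq_factorial_mul_choose, Nat.cast_mul, Finsupp.add_apply]

lemma prod_factorial_div_pow_eq {s : Finset ℕ} {μ : ℕ →₀ ℕ} (hs : μ.support ⊆ s) (R : ℕ → ℝ) :
    ∏ j ∈ s, ((μ j)! : ℝ) / R j ^ μ j = multiFactorial μ / multiPow R μ := by
  rw [Finset.prod_div_distrib, multiFactorial, multiPow,
    Finsupp.prod_of_support_subset _ hs _ fun _ _ => by simp,
    Finsupp.prod_of_support_subset _ hs _ fun _ _ => by simp]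

lemma IsStripHolomorphic.norm_mixedDeriv_toC_le {κ C : ℝ} {R : ℕ → ℝ}
    (hG : IsStripHolomorphic G) (hκ0 : 0 ≤ κ) (hκπ : κ < Real.pi / 2) (hC0 : 0 ≤ C)
    (hC : ∀ a, ‖imL a‖ ≤ κ → ‖G a‖ ≤ C * Real.exp ‖reL a‖) (μ : ℕ → ℕ) (hR : ∀ j, 0 ≤ R j)
    (hμR : ∀ j, μ j ≠ 0 → R j ≠ 0) (n : ℕ)
    (hκ : ∀ᵐ x ∂m, ∑ j ∈ Finset.range n, R j * |ψ j x| ≤ κ) (a : Lp ℝ ∞ m) :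
    ‖LogGaussian.mixedDeriv (fun j => toC (ψ j)) μ G n (toC a)‖ ≤
      (∏ j ∈ Finset.range n, ((μ j)! : ℝ) / R j ^ μ j) *
        (C * Real.exp κ * Real.exp ‖a‖) := by
  refine norm_mixedDeriv_le isOpen_strip hG.analyticOnNhd _ μ hR hμR n _ fun z hz => ?_
  have hsum := norm_sum_smul_toC_le hκ0 hκ hz
  set w := ∑ j ∈ Finset.range n, z j • toC (ψ j)
  have him : ‖imL (toC a + w)‖ ≤ κ := by
    rw [map_add, imL_toC, zero_add]
    exact (norm_imL_le w).trans hsum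
  have hre : ‖reL (toC a + w)‖ ≤ κ + ‖a‖ := by
    rw [map_add, reL_toC, add_comm κ]
    exact (norm_add_le _ _).trans (add_le_add_right ((norm_reL_le w).trans hsum) _)
  refine ⟨him.trans_lt hκπ, (hC _ him).trans ?_⟩
  rw [mul_assoc, ← Real.exp_add]
  gcongr

lemma IsGaussianCoeff.sum_multiChoose_mul_le {X : Type*} [NormedAddCommGroup X]
    [InnerProductSpace ℂ X] [CompleteSpace X] {G : Lp ℂ ∞ m → X} {κ C : ℝ} {R : ℕ → ℝ}
    (hb : IsGaussianCoeff ψ b) (hG : IsStripHolomorphic G) (hκ0 : 0 ≤ κ)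
    (hκπ : κ < Real.pi / 2) (hC0 : 0 ≤ C)
    (hC : ∀ a, ‖imL a‖ ≤ κ → ‖G a‖ ≤ C * Real.exp ‖reL a‖) (μ : ℕ →₀ ℕ) (hR : ∀ j, 0 ≤ R j)
    (hμR : ∀ j, μ j ≠ 0 → R j ≠ 0)
    (hκ : ∀ n, ∀ᵐ x ∂m, ∑ j ∈ Finset.range n, R j * |ψ j x| ≤ κ) (T : Finset (ℕ →₀ ℕ)) :
    ∑ α ∈ T, multiChoose (α + μ) μ * ‖hermiteCoeff (fun y => G (toC (b y))) (α + μ)‖ ^ 2 ≤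
      multiFactorial μ / multiPow R (2 • μ) *
        ((C * Real.exp κ) ^ 2 * ∫ y, Real.exp ‖b y‖ ^ 2 ∂gaussian) := by
  obtain ⟨n, hn⟩ : ∃ n, μ.support ⊆ Finset.range n := μ.support.exists_nat_subset_range
  let M : (ℕ → ℝ) → X := fun y => mixedDeriv (fun j => toC (ψ j)) μ G n (toC (b y))
  have hM : MemLp M 2 gaussian := hb.memLp_comp (hG.mixedDeriv _ _ _)
  have hμ : ∑ j ∈ Finset.range n, Finsupp.single j (μ j) = μ := by
    conv_rhs => rw [← μ.sum_single]
    exact (Finsupp.sum_of_support_subset _ hn _ fun _ _ => Finsupp.single_zero _).symm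
  have hcoeff : ∀ α, ‖hermiteCoeff M α‖ ^ 2 = multiFactorial μ *
      (multiChoose (α + μ) μ * ‖hermiteCoeff (fun y => G (toC (b y))) (α + μ)‖ ^ 2) := by
    intro α
    rw [hb.norm_hermiteCoeff_mixedDeriv_sq hG μ n α, hμ, prod_ascFactorial_eq hn, mul_assoc]
  have hbound : ∀ y, ‖M y‖ ≤
      multiFactorial μ / multiPow R μ * (C * Real.exp κ) * Real.exp ‖b y‖ := by
    intro y
    rw [← prod_factorial_div_pow_eq hn, mul_assoc]
    exact hG.norm_mixedDeriv_toC_le hκ0 hκπ hC0 hC μ hR hμR n (hκ n) (b y)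
  let _ : InnerProductSpace ℝ X := InnerProductSpace.complexToReal
  have hbessel := (sum_norm_hermiteCoeff_sq_le hM T).trans (hb.integral_norm_sq_le hM hbound)
  simp only [hcoeff, ← Finset.mul_sum] at hbessel
  have hfactorial : 0 < multiFactorial μ := multiFactorial_pos μ
  refine le_of_mul_le_mul_left (hbessel.trans_eq ?_) hfactorial
  rw [multiPow_two_smul_eq_sq]
  ring

end GaussianCoefficient

section Poincare

lemma integrable_sq_of_hasCompactSupport {X : Type*} [TopologicalSpace X] [MeasurableSpace X]
    [OpensMeasurableSpace X] {μ : Measure X} [IsFiniteMeasureOnCompacts μ] {g : X → ℝ}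
    (hg : Continuous g) (hc : HasCompactSupport g) : Integrable (fun x => g x ^ 2) μ := by
  simp only [sq]
  exact (hg.mul hg).integrable_of_hasCompactSupport hc.mul_left

variable {E : Type*} [NormedAddCommGroup E] [NormedSpace ℝ E] [MeasurableSpace E] [BorelSpace E]
  {μ : Measure E} {η : E → ℝ} {l : E →L[ℝ] ℝ} {e : E}

lemma integrable_mul_fderiv_mul [IsFiniteMeasureOnCompacts μ] (hη : ContDiff ℝ 1 η)
    (hc : HasCompactSupport η) : Integrable (fun x => 2 * η x * fderiv ℝ η x e * l x) μ :=
  (((continuous_const.mul hη.continuous).mul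
    ((hη.continuous_fderiv one_ne_zero).clm_apply continuous_const)).mul
      l.continuous).integrable_of_hasCompactSupport hc.mul_left.mul_right.mul_right

variable [FiniteDimensional ℝ E] [μ.IsAddHaarMeasure]

lemma integral_sq_eq_neg_integral (hη : ContDiff ℝ 1 η) (hc : HasCompactSupport η)
    (hle : l e = 1) :
    ∫ x, η x ^ 2 ∂μ = -∫ x, 2 * η x * fderiv ℝ η x e * l x ∂μ := by
  have hdiff : Differentiable ℝ η := hη.differentiable one_ne_zero
  have hderiv : ∀ x, fderiv ℝ (fun x => η x ^ 2) x e = 2 * η x * fderiv ℝ η x e := fun x => by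
    rw [fderiv_fun_pow 2 (hdiff x)]
    simp
  have hint_mul : Integrable (fun x => η x ^ 2 * l x) μ := by
    simp only [sq]
    exact ((hη.continuous.mul hη.continuous).mul l.continuous).integrable_of_hasCompactSupport
      hc.mul_left.mul_right
  have hparts := integral_mul_fderiv_eq_neg_fderiv_mul_of_integrable (μ := μ)
    (f := fun x => η x ^ 2) (g := l) (v := e)
    (by simpa only [hderiv] using integrable_mul_fderiv_mul hη hc)
    (by simpa only [l.fderiv, hle, mul_one] using
      integrable_sq_of_hasCompactSupport hη.continuous hc)
    hint_mul (fun x _ => (hdiff x).pow 2) (fun x _ => l.differentiableAt)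
  simpa only [l.fderiv, hle, mul_one, hderiv] using hparts

lemma integral_sq_le_integral_fderiv_sq (hη : ContDiff ℝ 1 η) (hc : HasCompactSupport η)
    (hle : l e = 1) {R : ℝ} (hR : ∀ x, η x ≠ 0 → |l x| ≤ R) :
    ∫ x, η x ^ 2 ∂μ ≤ 4 * R ^ 2 * ∫ x, fderiv ℝ η x e ^ 2 ∂μ := by
  have hint : Integrable (fun x => η x ^ 2) μ :=
    integrable_sq_of_hasCompactSupport hη.continuous hc
  have hint_deriv : Integrable (fun x => fderiv ℝ η x e ^ 2) μ :=
    integrable_sq_of_hasCompactSupport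
      ((hη.continuous_fderiv one_ne_zero).clm_apply continuous_const) (hc.fderiv_apply ℝ e)
  have hyoung : ∀ x, -(2 * η x * fderiv ℝ η x e * l x) ≤
      1 / 2 * η x ^ 2 + 2 * R ^ 2 * fderiv ℝ η x e ^ 2 := by
    intro x
    rcases eq_or_ne (η x) 0 with hzero | hne
    · rw [hzero]
      nlinarith [mul_nonneg (sq_nonneg R) (sq_nonneg (fderiv ℝ η x e))]
    · have hl : l x ^ 2 ≤ R ^ 2 := sq_le_sq.2 ((hR x hne).trans (le_abs_self R))
      nlinarith [sq_nonneg (η x + 2 * (fderiv ℝ η x e * l x)),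
        mul_le_mul_of_nonneg_right hl (sq_nonneg (fderiv ℝ η x e))]
  have hmono := integral_mono (integrable_mul_fderiv_mul hη hc).neg
    ((hint.const_mul (1 / 2)).add (hint_deriv.const_mul (2 * R ^ 2))) hyoung
  simp only [Pi.neg_apply, Pi.add_apply] at hmono
  rw [integral_neg, ← integral_sq_eq_neg_integral hη hc hle,
    integral_add (hint.const_mul _) (hint_deriv.const_mul _), integral_const_mul,
    integral_const_mul] at hmono
  linarith

lemma integral_sq_le_integral_norm_gradient_sq {d : ℕ} (hd : 1 ≤ d) {η : Space d → ℝ}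
    (hη : ContDiff ℝ 1 η) (hc : HasCompactSupport η) {R : ℝ} (hR : ∀ x, η x ≠ 0 → ‖x‖ ≤ R) :
    ∫ x, η x ^ 2 ≤ 4 * R ^ 2 * ∫ x, ‖∇ η x‖ ^ 2 := by
  let e : Space d := EuclideanSpace.single ⟨0, hd⟩ 1
  have he : ‖e‖ = 1 := by simp [e]
  have hle : innerSL ℝ e e = 1 := by
    rw [innerSL_apply_apply, real_inner_self_eq_norm_sq, he, one_pow]
  have hl : ∀ x, |innerSL ℝ e x| ≤ ‖x‖ := fun x =>
    (abs_real_inner_le_norm e x).trans_eq (by rw [he, one_mul])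
  have hderiv : ∀ x, |fderiv ℝ η x e| ≤ ‖fderiv ℝ η x‖ := fun x =>
    ((fderiv ℝ η x).le_opNorm e).trans_eq (by rw [he, mul_one])
  have hgradient : ∀ x, ‖∇ η x‖ = ‖fderiv ℝ η x‖ := fun x => LinearIsometryEquiv.norm_map _ _
  have hcont := hη.continuous_fderiv one_ne_zero
  refine (integral_sq_le_integral_fderiv_sq hη hc hle fun x hx => (hl x).trans (hR x hx)).trans ?_
  simp only [hgradient]
  refine mul_le_mul_of_nonneg_left (integral_mono ?_ ?_ fun x => ?_) (by positivity)
  · exact integrable_sq_of_hasCompactSupport (hcont.clm_apply continuous_const)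
      (hc.fderiv_apply ℝ e)
  · exact integrable_sq_of_hasCompactSupport hcont.norm (hc.fderiv ℝ).norm
  · exact sq_le_sq.2 ((hderiv x).trans (le_abs_self _))

lemma norm_sq_eq_integral_of_ae_eq_restrict {α F : Type*} [MeasurableSpace α] {μ : Measure α}
    [NormedAddCommGroup F] [InnerProductSpace ℝ F] {D : Set α} {p : Lp F 2 (μ.restrict D)}
    {g : α → F} (hp : p =ᵐ[μ.restrict D] g) (hg : ∀ x ∉ D, g x = 0) :
    ‖p‖ ^ 2 = ∫ x, ‖g x‖ ^ 2 ∂μ := by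
  have hzero : ∀ x ∉ D, ‖g x‖ ^ 2 = 0 := fun x hx => by
    rw [hg x hx, norm_zero, zero_pow two_ne_zero]
  rw [norm_sq_eq_integral (𝕜 := ℝ), ← setIntegral_eq_integral_of_forall_compl_eq_zero hzero]
  refine integral_congr_ae ?_
  filter_upwards [hp] with x hx
  rw [hx]

variable {d : ℕ} {D : Set (Space d)}

lemma norm_fst_le_of_mem_testPairs (hd : 1 ≤ d) {R : ℝ} (hR0 : 0 ≤ R) (hR : ∀ x ∈ D, ‖x‖ ≤ R)
    {p : L2Pair D} (hp : p ∈ testPairs D) : ‖p.fst‖ ≤ 2 * R * ‖p.snd‖ := by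
  obtain ⟨η, hη, hc, hs, hfst, hsnd⟩ := hp
  have hzero : ∀ x ∉ D, η x = 0 := fun x hx => image_eq_zero_of_notMem_tsupport fun h => hx (hs h)
  have hgradient : ∀ x ∉ D, ∇ η x = 0 := fun x hx => by
    rw [gradient, fderiv_of_notMem_tsupport (𝕜 := ℝ) fun h => hx (hs h), map_zero]
  have hpoincare := integral_sq_le_integral_norm_gradient_sq hd (hη.of_le (by simp)) hc
    fun x hx => hR x (by_contra fun h => hx (hzero x h))
  have hfst_sq := norm_sq_eq_integral_of_ae_eq_restrict hfst hzero
  simp only [Real.norm_eq_abs, sq_abs] at hfst_sq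
  rw [← hfst_sq, ← norm_sq_eq_integral_of_ae_eq_restrict hsnd hgradient] at hpoincare
  refine (sq_le_sq₀ (norm_nonneg _) (by positivity)).1 (hpoincare.trans_eq ?_)
  ring

/-- The Poincaré inequality on `H¹₀(D)`: the norm of `V` is equivalent to the norm of `H¹(D)`. -/
def HasPoincare {d : ℕ} (D : Set (Space d)) : Prop :=
  ∃ C : ℝ, 0 < C ∧ ∀ v : H10 D, ‖v‖ ≤ C * normV v

lemma hasPoincare_of_isBounded (hd : 1 ≤ d) (hD : Bornology.IsBounded D) : HasPoincare D := by
  obtain ⟨R, hR0, hR⟩ := hD.exists_pos_norm_le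
  have hclosed : IsClosed {p : L2Pair D | ‖p.fst‖ ≤ 2 * R * ‖p.snd‖} :=
    isClosed_le (WithLp.fstL 2 ℝ _ _).continuous.norm
      ((WithLp.sndL 2 ℝ _ _).continuous.norm.const_mul _)
  have hfst : ∀ v : H10 D, ‖(v : L2Pair D).fst‖ ≤ 2 * R * normV v := fun v =>
    closure_minimal (fun _ hp => norm_fst_le_of_mem_testPairs hd hR0.le hR hp) hclosed v.2
  refine ⟨2 * R + 1, by positivity, fun v => ?_⟩
  have hsum : ‖v‖ ^ 2 = ‖(v : L2Pair D).fst‖ ^ 2 + normV v ^ 2 :=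
    WithLp.prod_norm_sq_eq_of_L2 (v : L2Pair D)
  have hnormV : 0 ≤ normV v := norm_nonneg _
  refine (sq_le_sq₀ (norm_nonneg _) (by positivity)).1 ?_
  nlinarith [pow_le_pow_left₀ (norm_nonneg _) (hfst v) 2, mul_nonneg hR0.le (sq_nonneg (normV v))]

end Poincare

section WeakForm

variable {d : ℕ} {D : Set (Space d)}

variable (D) in
/-- The weak gradient on `H¹₀(D)`, as a continuous linear map. -/
def gradL : H10 D →L[ℝ] Lp (Space d) 2 (volume.restrict D) :=
  (WithLp.sndL 2 ℝ _ _) ∘L (H10 D).subtypeL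

/-- The bilinear form `(u, v) ↦ ∫ exp(b) ∇u · ∇v`. -/
def weakForm (b : LInf D) : H10 D →L[ℝ] H10 D →L[ℝ] ℝ :=
  (innerSL ℝ).bilinearComp (NormedSpace.exp (mulOp _ (Space d) b) ∘L gradL D) (gradL D)

lemma weakForm_apply (b : LInf D) (u v : H10 D) :
    weakForm b u v = ∫ x in D, Real.exp (b x) * inner ℝ (grad u x) (grad v x) := by
  have happly : weakForm b u v =
      inner ℝ (NormedSpace.exp (mulOp _ (Space d) b) (grad u)) (grad v) := rfl
  rw [happly, L2.inner_def]
  refine integral_congr_ae ?_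
  filter_upwards [coeFn_exp_mulOp b (grad u)] with x hx
  rw [hx, real_inner_smul_left, Real.exp_eq_exp_ℝ]

lemma isCoercive_weakForm (hD : HasPoincare D) (b : LInf D) : IsCoercive (weakForm b) := by
  obtain ⟨C, hC0, hC⟩ := hD
  refine ⟨Real.exp (-‖b‖) / C ^ 2, by positivity, fun v => ?_⟩
  have hexp : ∀ᵐ x ∂volume.restrict D, Real.exp (-‖b‖) ≤ RCLike.re (NormedSpace.exp (b x)) := by
    filter_upwards [ae_norm_le_norm_of_top b] with x hx
    rw [← Real.exp_eq_exp_ℝ]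
    exact Real.exp_le_exp.2 ((neg_le_neg hx).trans (neg_abs_le _))
  calc Real.exp (-‖b‖) / C ^ 2 * ‖v‖ * ‖v‖ = Real.exp (-‖b‖) / C ^ 2 * ‖v‖ ^ 2 := by ring
    _ ≤ Real.exp (-‖b‖) / C ^ 2 * (C * normV v) ^ 2 := by
      gcongr
      exact hC v
    _ = Real.exp (-‖b‖) * ‖grad v‖ ^ 2 := by
      rw [mul_pow, ← mul_assoc, div_mul_cancel₀ _ (by positivity), normV]
    _ ≤ weakForm b v v := mul_norm_sq_le_re_inner_exp_mulOp hexp (grad v)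

lemma existsUnique_isWeakSolution (hD : HasPoincare D) (b : LInf D) (f : H10 D →L[ℝ] ℝ) :
    ∃! u : H10 D, IsWeakSolution b f u := by
  let A := (isCoercive_weakForm hD b).continuousLinearEquivOfBilin
  let F : H10 D := (InnerProductSpace.toDual ℝ (H10 D)).symm f
  have hiff : ∀ u, IsWeakSolution b f u ↔ A u = F := by
    intro u
    rw [ext_iff_inner_right ℝ]
    refine forall_congr' fun v => ?_
    rw [IsCoercive.continuousLinearEquivOfBilin_apply, InnerProductSpace.toDual_symm_apply,
      weakForm_apply]
  simp only [hiff]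
  exact A.bijective.existsUnique F

end WeakForm

section Complexification

variable {d : ℕ} {D : Set (Space d)}

variable (d) in
/-- The inclusion of `ℝ^d` into `ℂ^d`. -/
def complexifyVec : Space d →L[ℝ] EuclideanSpace ℂ (Fin d) :=
  LinearMap.toContinuousLinearMap
    { toFun := fun x => WithLp.toLp 2 fun i => (x i : ℂ)
      map_add' := fun x y => by ext i; simp
      map_smul' := fun c x => by ext i; simp }

lemma complexifyVec_apply (x : Space d) (i : Fin d) : complexifyVec d x i = (x i : ℂ) := rfl

lemma inner_complexifyVec (x y : Space d) :
    inner ℂ (complexifyVec d x) (complexifyVec d y) = ((inner ℝ x y : ℝ) : ℂ) := by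
  simp [PiLp.inner_apply, complexifyVec_apply]

lemma norm_complexifyVec (x : Space d) : ‖complexifyVec d x‖ = ‖x‖ := by
  simp [EuclideanSpace.norm_eq, complexifyVec_apply]

variable (D) in
/-- The weak gradient on `H¹₀(D)`, as a complex vector field. -/
def cgrad : H10 D →L[ℝ] Lp (EuclideanSpace ℂ (Fin d)) 2 (volume.restrict D) :=
  ((complexifyVec d).compLpL 2 (volume.restrict D)) ∘L gradL D

lemma coeFn_cgrad (v : H10 D) :
    cgrad D v =ᵐ[volume.restrict D] fun x => complexifyVec d (grad v x) :=
  (complexifyVec d).coeFn_compLpL (grad v)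

lemma norm_cgrad (v : H10 D) : ‖cgrad D v‖ = normV v := by
  rw [normV, Lp.norm_def, Lp.norm_def]
  refine congrArg ENNReal.toReal (eLpNorm_congr_norm_ae ?_)
  filter_upwards [coeFn_cgrad v] with x hx
  rw [hx, norm_complexifyVec]

variable (D) in
/-- The closed complex subspace spanned by the gradients of `H¹₀(D)`. -/
abbrev gradSpace : Submodule ℂ (Lp (EuclideanSpace ℂ (Fin d)) 2 (volume.restrict D)) :=
  (Submodule.span ℂ (Set.range (cgrad D))).topologicalClosure

lemma cgrad_mem_gradSpace (v : H10 D) : cgrad D v ∈ gradSpace D :=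
  Submodule.le_topologicalClosure _ (Submodule.subset_span ⟨v, rfl⟩)

lemma mem_orthogonal_topologicalClosure_span {𝕜 H : Type*} [RCLike 𝕜] [NormedAddCommGroup H]
    [InnerProductSpace 𝕜 H] {s : Set H} {w : H} (hw : ∀ g ∈ s, inner 𝕜 w g = 0) :
    w ∈ (Submodule.span 𝕜 s).topologicalClosureᗮ := by
  rw [Submodule.orthogonal_closure, Submodule.mem_orthogonal']
  exact fun g hg => Submodule.span_le (p := LinearMap.ker (innerₛₗ 𝕜 w)) |>.2 hw hg

lemma inner_exp_mulOp_cgrad (b : LInf D) (u v : H10 D) :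
    inner ℂ (NormedSpace.exp (mulOp _ (EuclideanSpace ℂ (Fin d)) (toC b)) (cgrad D u))
        (cgrad D v) =
      ((∫ x in D, Real.exp (b x) * inner ℝ (grad u x) (grad v x) : ℝ) : ℂ) := by
  rw [L2.inner_def]
  refine Eq.trans (integral_congr_ae ?_) (integral_ofReal (𝕜 := ℂ))
  filter_upwards [coeFn_exp_mulOp (toC b) (cgrad D u), coeFn_cgrad u, coeFn_cgrad v, coeFn_toC b]
    with x hexp hu hv hb
  rw [hexp, hu, hv, hb, inner_smul_left, inner_complexifyVec, ← Complex.exp_eq_exp_ℂ,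
    ← Complex.ofReal_exp, Complex.conj_ofReal]
  exact (Complex.ofReal_mul _ _).symm

lemma cgrad_eq_solveOp {f : H10 D →L[ℝ] ℝ} {u₀ u : H10 D} {b : LInf D}
    (h₀ : IsWeakSolution 0 f u₀) (h : IsWeakSolution b f u) :
    cgrad D u = (solveOp (gradSpace D) ⟨cgrad D u₀, cgrad_mem_gradSpace u₀⟩ (toC b) :
      Lp (EuclideanSpace ℂ (Fin d)) 2 (volume.restrict D)) := by
  have hinner : ∀ v, inner ℂ
      (NormedSpace.exp (mulOp _ (EuclideanSpace ℂ (Fin d)) (toC b)) (cgrad D u) - cgrad D u₀)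
      (cgrad D v) = 0 := by
    intro v
    have hsol₀ := inner_exp_mulOp_cgrad 0 u₀ v
    rw [map_zero, map_zero, NormedSpace.exp_zero, one_apply_eq_self] at hsol₀
    rw [inner_sub_left, inner_exp_mulOp_cgrad, hsol₀, h v, h₀ v, sub_self]
  have horth := mem_orthogonal_topologicalClosure_span (Set.forall_mem_range.2 hinner)
  refine congrArg Subtype.val ((formOp_eq_iff_eq_solveOp (gradSpace D) (toC_mem_strip b)
    (g := ⟨cgrad D u, cgrad_mem_gradSpace u⟩)).1 (ext_inner_right ℂ fun k => ?_))
  rw [inner_formOp, ← sub_eq_zero]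
  exact (inner_sub_left _ _ _).symm.trans ((Submodule.mem_orthogonal' _ _).1 horth k k.2)

end Complexification

section ExponentialMoments

lemma integrable_exp_sq_add_abs (c : ℝ) :
    Integrable (fun t : ℝ => Real.exp (t ^ 2 / 4 + c * |t|)) (gaussianReal 0 1) := by
  rw [← integrable_gaussianPDFReal_smul_iff one_ne_zero]
  have hint := (integrable_exp_neg_mul_sq (b := 1 / 8) (by norm_num)).const_mul
    ((√(2 * Real.pi))⁻¹ * Real.exp (2 * c ^ 2))
  refine hint.mono' ?_ (ae_of_all _ fun t => ?_)
  · simp only [gaussianPDFReal_def, smul_eq_mul]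
    exact Continuous.aestronglyMeasurable (by fun_prop)
  · rw [norm_smul, Real.norm_of_nonneg (gaussianPDFReal_nonneg _ _ _),
      Real.norm_of_nonneg (Real.exp_pos _).le, gaussianPDFReal_def]
    simp only [NNReal.coe_one, mul_one, sub_zero]
    rw [mul_assoc, mul_assoc, ← Real.exp_add, ← Real.exp_add]
    refine mul_le_mul_of_nonneg_left (Real.exp_le_exp.2 ?_) (by positivity)
    nlinarith [sq_nonneg (|t| - 4 * c), sq_abs t]

lemma exists_forall_inv_le {lam : ℕ → ℝ} (hlam : ∀ j, 0 < lam j)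
    (hsum : Summable fun j => Real.exp (-(lam j) ^ 2)) : ∃ A : ℝ, ∀ j, (lam j)⁻¹ ≤ A := by
  have hsq : Tendsto (fun j => lam j ^ 2) atTop atTop :=
    tendsto_neg_atBot_iff.1 (Real.tendsto_exp_comp_nhds_zero.1 hsum.tendsto_atTop_zero)
  have hinv : Tendsto (fun j => (lam j)⁻¹) atTop (𝓝 0) := by
    refine ((Real.tendsto_sqrt_atTop.comp hsq).congr fun j => ?_).inv_tendsto_atTop
    exact Real.sqrt_sq (hlam j).le
  obtain ⟨A, hA⟩ := hinv.bddAbove_range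
  exact ⟨A, fun j => hA ⟨j, rfl⟩⟩

lemma exp_mul_abs_div_le {a A k : ℝ} (ha : 0 < a) (hA : a⁻¹ ≤ A) (hk : 0 ≤ k) (t : ℝ) :
    Real.exp (k * |t| / a) ≤
      Real.exp (2 * k) + Real.exp (-a ^ 2) * Real.exp (t ^ 2 / 4 + k * A * |t|) := by
  rw [← Real.exp_add]
  rcases le_or_gt |t| (2 * a) with hle | hgt
  · refine le_add_of_le_of_nonneg (Real.exp_le_exp.2 ?_) (Real.exp_pos _).le
    rw [div_le_iff₀ ha]
    nlinarith
  · refine le_add_of_nonneg_of_le (Real.exp_pos _).le (Real.exp_le_exp.2 ?_)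
    have hdiv : k * |t| / a ≤ k * A * |t| := by
      rw [div_eq_mul_inv, mul_right_comm]
      gcongr
    nlinarith [sq_abs t]

lemma exists_exp_majorant {lam : ℕ → ℝ} (hlam : ∀ j, 0 < lam j)
    (hsum : Summable fun j => Real.exp (-(lam j) ^ 2)) {k : ℝ} (hk : 0 ≤ k) :
    ∃ Z : (ℕ → ℝ) → ℝ≥0∞, Measurable Z ∧ ∫⁻ y, Z y ∂gaussian ≠ ⊤ ∧
      ∀ y j, ENNReal.ofReal (Real.exp (k * |y j| / lam j)) ≤ Z y := by
  obtain ⟨A, hA⟩ := exists_forall_inv_le hlam hsum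
  let g : ℝ → ℝ≥0∞ := fun t => ENNReal.ofReal (Real.exp (t ^ 2 / 4 + k * A * |t|))
  let c : ℕ → ℝ≥0∞ := fun j => ENNReal.ofReal (Real.exp (-(lam j) ^ 2))
  have hg : Measurable g := by fun_prop
  have hterm : ∀ j, Measurable fun y : ℕ → ℝ => c j * g (y j) := fun j =>
    (hg.comp (measurable_pi_apply j)).const_mul _
  refine ⟨fun y => ENNReal.ofReal (Real.exp (2 * k)) + ∑' j, c j * g (y j),
    measurable_const.add (Measurable.tsum hterm), ?_, fun y j => ?_⟩
  · have hlintegral : ∀ j, ∫⁻ y, c j * g (y j) ∂gaussian =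
        c j * ∫⁻ t, g t ∂(gaussianReal 0 1) := fun j => by
      have hmeas : Measurable fun y : ℕ → ℝ => g (y j) := hg.comp (measurable_pi_apply j)
      rw [lintegral_const_mul _ hmeas]
      exact congrArg (c j * ·)
        ((measurePreserving_eval_infinitePi (fun _ : ℕ => gaussianReal 0 1) j).lintegral_comp hg)
    rw [lintegral_add_left measurable_const, lintegral_const, measure_univ, mul_one,
      lintegral_tsum fun j => (hterm j).aemeasurable]
    simp only [hlintegral, ENNReal.tsum_mul_right]
    exact ENNReal.add_ne_top.2 ⟨ENNReal.ofReal_ne_top, ENNReal.mul_ne_top hsum.tsum_ofReal_ne_top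
      (integrable_exp_sq_add_abs (k * A)).lintegral_lt_top.ne⟩
  · refine (ENNReal.ofReal_le_ofReal (exp_mul_abs_div_le (hlam j) (hA j) hk (y j))).trans ?_
    rw [ENNReal.ofReal_add (Real.exp_pos _).le (by positivity),
      ENNReal.ofReal_mul (Real.exp_pos _).le]
    exact add_le_add_right (ENNReal.le_tsum j) _

end ExponentialMoments

section SeriesInLp

variable {Ω : Type*} [MeasurableSpace Ω] {m : Measure Ω}

lemma ae_tendsto_of_tendsto_top {E : Type*} [NormedAddCommGroup E] {f : ℕ → Lp E ∞ m}
    {g : Lp E ∞ m} (h : Tendsto f atTop (𝓝 g)) :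
    ∀ᵐ x ∂m, Tendsto (fun n => f n x) atTop (𝓝 (g x)) := by
  have hle : ∀ᵐ x ∂m, ∀ n, ‖f n x - g x‖ ≤ ‖f n - g‖ := by
    refine ae_all_iff.2 fun n => ?_
    filter_upwards [Lp.coeFn_sub (f n) g, ae_norm_le_norm_of_top (f n - g)] with x hsub hx
    rwa [hsub] at hx
  filter_upwards [hle] with x hx
  exact tendsto_iff_norm_sub_tendsto_zero.2
    (squeeze_zero (fun _ => norm_nonneg _) hx (tendsto_iff_norm_sub_tendsto_zero.1 h))

lemma coeFn_sum_smul {ι : Type*} (c : ι → ℝ) (g : ι → Lp ℝ ∞ m) (s : Finset ι) :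
    (∑ j ∈ s, c j • g j : Lp ℝ ∞ m) =ᵐ[m] fun x => ∑ j ∈ s, c j * g j x := by
  have hterm : ∀ᵐ x ∂m, ∀ j ∈ s, (c j • g j : Lp ℝ ∞ m) x = c j * g j x :=
    (Finset.eventually_all s).2 fun j _ => Lp.coeFn_smul (c j) (g j)
  filter_upwards [Lp.coeFn_finsetSum s fun j => c j • g j, hterm] with x hsum hx
  rw [hsum, Finset.sum_apply]
  exact Finset.sum_congr rfl hx

variable {ψ : ℕ → Lp ℝ ∞ m} {lam y : ℕ → ℝ} {M : ℝ}

lemma norm_sum_smul_le (hM0 : 0 ≤ M) (hM : ∀ j, |y j| ≤ M * lam j) (s : Finset ℕ) :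
    ‖∑ j ∈ s, y j • ψ j‖ ≤ M * ‖∑ j ∈ s, lam j • |ψ j|‖ := by
  refine norm_le_of_ae_norm_le_of_top (by positivity) ?_
  have habs : ∀ᵐ x ∂m, ∀ j, (|ψ j| : Lp ℝ ∞ m) x = |ψ j x| :=
    ae_all_iff.2 fun j => Lp.coeFn_abs (ψ j)
  filter_upwards [coeFn_sum_smul y ψ s, coeFn_sum_smul lam (fun j => |ψ j|) s, habs,
    ae_norm_le_norm_of_top (∑ j ∈ s, lam j • |ψ j|)] with x hsum hsum_abs habs hx
  refine le_trans ?_ (mul_le_mul_of_nonneg_left ((le_abs_self _).trans hx) hM0)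
  rw [hsum, hsum_abs, Finset.mul_sum]
  refine (norm_sum_le _ _).trans (Finset.sum_le_sum fun j _ => ?_)
  rw [norm_mul, habs, Real.norm_eq_abs, Real.norm_eq_abs, ← mul_assoc]
  exact mul_le_mul_of_nonneg_right (hM j) (abs_nonneg _)

lemma exists_tendsto_sum_smul (hM0 : 0 ≤ M) (hM : ∀ j, |y j| ≤ M * lam j) {S : Lp ℝ ∞ m}
    (hS : Tendsto (fun n => ∑ j ∈ Finset.range n, lam j • |ψ j|) atTop (𝓝 S)) :
    ∃ b, Tendsto (fun n => ∑ j ∈ Finset.range n, y j • ψ j) atTop (𝓝 b) ∧ ‖b‖ ≤ M * ‖S‖ := by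
  have hcauchy : CauchySeq fun n => ∑ j ∈ Finset.range n, y j • ψ j := by
    refine Metric.cauchySeq_iff'.2 fun ε hε => ?_
    obtain ⟨N, hN⟩ := Metric.cauchySeq_iff'.1 hS.cauchySeq (ε / (M + 1)) (by positivity)
    refine ⟨N, fun n hn => ?_⟩
    have hlt := hN n hn
    rw [dist_eq_norm, ← Finset.sum_Ico_eq_sub _ hn] at hlt ⊢
    calc ‖∑ j ∈ Finset.Ico N n, y j • ψ j‖
        ≤ M * ‖∑ j ∈ Finset.Ico N n, lam j • |ψ j|‖ := norm_sum_smul_le hM0 hM _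
      _ ≤ (M + 1) * ‖∑ j ∈ Finset.Ico N n, lam j • |ψ j|‖ := by gcongr; linarith
      _ < (M + 1) * (ε / (M + 1)) := by gcongr
      _ = ε := by field_simp
  obtain ⟨b, hb⟩ := cauchySeq_tendsto_of_complete hcauchy
  exact ⟨b, hb, le_of_tendsto_of_tendsto' hb.norm (hS.norm.const_mul M)
    fun n => norm_sum_smul_le hM0 hM _⟩

lemma exists_tendsto_sum_smul_exp_norm_le {z : ℝ} (hlam : ∀ j, 0 < lam j) {S : Lp ℝ ∞ m}
    (hS : Tendsto (fun n => ∑ j ∈ Finset.range n, lam j • |ψ j|) atTop (𝓝 S))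
    (hz : ∀ j, Real.exp ((2 * ‖S‖ + 1) * |y j| / lam j) ≤ z) :
    ∃ b, Tendsto (fun n => ∑ j ∈ Finset.range n, y j • ψ j) atTop (𝓝 b) ∧
      Real.exp ‖b‖ ^ 2 ≤ z := by
  have hk : 0 < 2 * ‖S‖ + 1 := by positivity
  have hz0 : 0 < z := (Real.exp_pos _).trans_le (hz 0)
  have hlog : ∀ j, (2 * ‖S‖ + 1) * |y j| / lam j ≤ Real.log z := fun j =>
    (Real.le_log_iff_exp_le hz0).2 (hz j)
  have hlog0 : 0 ≤ Real.log z :=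
    (div_nonneg (mul_nonneg hk.le (abs_nonneg _)) (hlam 0).le).trans (hlog 0)
  have hM : ∀ j, |y j| ≤ Real.log z / (2 * ‖S‖ + 1) * lam j := fun j => by
    rw [div_mul_eq_mul_div, le_div_iff₀ hk, mul_comm |y j|, ← div_le_iff₀ (hlam j)]
    exact hlog j
  obtain ⟨b, hb, hnorm⟩ := exists_tendsto_sum_smul (by positivity) hM hS
  refine ⟨b, hb, ?_⟩
  rw [← Real.exp_nat_mul, ← Real.le_log_iff_exp_le hz0, Nat.cast_ofNat]
  rw [div_mul_eq_mul_div, le_div_iff₀ hk] at hnorm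
  nlinarith [norm_nonneg b]

end SeriesInLp

section LogCoeff

variable {d : ℕ} {D : Set (Space d)} {ψ : ℕ → LInf D} {y : ℕ → ℝ} {b : LInf D}

lemma isLogCoeff_of_tendsto
    (h : Tendsto (fun n => ∑ j ∈ Finset.range n, y j • ψ j) atTop (𝓝 b)) :
    IsLogCoeff ψ y b := by
  filter_upwards [ae_tendsto_of_tendsto_top h,
    ae_all_iff.2 fun n => coeFn_sum_smul y ψ (Finset.range n)] with x hx hsum
  simpa only [hsum] using hx

lemma IsLogCoeff.unique {b' : LInf D} (h : IsLogCoeff ψ y b) (h' : IsLogCoeff ψ y b') :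
    b = b' := by
  refine Lp.ext ?_
  filter_upwards [h, h'] with x hx hx'
  exact tendsto_nhds_unique hx hx'

lemma sum_update_mul {ι : Type*} [DecidableEq ι] {s : Finset ι} {j : ι} (hj : j ∈ s)
    (y a : ι → ℝ) (t : ℝ) :
    ∑ i ∈ s, Function.update y j t i * a i = ∑ i ∈ s, y i * a i + (t - y j) * a j := by
  have herase : ∑ i ∈ s.erase j, Function.update y j t i * a i = ∑ i ∈ s.erase j, y i * a i :=
    Finset.sum_congr rfl fun i hi => by rw [Function.update_of_ne (Finset.ne_of_mem_erase hi)]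
  rw [← Finset.add_sum_erase _ _ hj, ← Finset.add_sum_erase _ (fun i => y i * a i) hj, herase,
    Function.update_self]
  ring

lemma IsLogCoeff.update (h : IsLogCoeff ψ y b) (j : ℕ) (t : ℝ) :
    IsLogCoeff ψ (Function.update y j t) (b + (t - y j) • ψ j) := by
  filter_upwards [h, Lp.coeFn_add b ((t - y j) • ψ j), Lp.coeFn_smul (t - y j) (ψ j)]
    with x hx hadd hsmul
  rw [hadd, Pi.add_apply, hsmul, Pi.smul_apply, smul_eq_mul]
  refine (hx.add_const ((t - y j) * ψ j x)).congr' ?_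
  filter_upwards [eventually_gt_atTop j] with n hn
  exact (sum_update_mul (Finset.mem_range.2 hn) y (fun i => ψ i x) t).symm

open Classical in
/-- The coefficient `b(y)`, with the value `0` outside of `U₀`. -/
def logCoeff (ψ : ℕ → LInf D) (y : ℕ → ℝ) : LInf D :=
  if h : ∃ b : LInf D, IsLogCoeff ψ y b then h.choose else 0

lemma logCoeff_eq (h : IsLogCoeff ψ y b) : logCoeff ψ y = b := by
  have hex : ∃ b : LInf D, IsLogCoeff ψ y b := ⟨b, h⟩
  rw [logCoeff, dif_pos hex]
  exact hex.choose_spec.unique h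

lemma SeriesAssumption.exists_majorant (hψ : SeriesAssumption ψ) :
    ∃ Z : (ℕ → ℝ) → ℝ≥0∞, ∫⁻ y, Z y ∂gaussian ≠ ⊤ ∧ ∀ᵐ y ∂gaussian, ∃ b : LInf D,
      Tendsto (fun n => ∑ j ∈ Finset.range n, y j • ψ j) atTop (𝓝 b) ∧
        ENNReal.ofReal (Real.exp ‖b‖ ^ 2) ≤ Z y := by
  obtain ⟨lam, hlam, hsum, S, hS⟩ := hψ
  obtain ⟨Z, hZ, hZint, hZle⟩ := exists_exp_majorant hlam hsum (k := 2 * ‖S‖ + 1) (by positivity)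
  refine ⟨Z, hZint, ?_⟩
  filter_upwards [ae_lt_top hZ hZint] with y hy
  obtain ⟨b, hb, hexp⟩ := exists_tendsto_sum_smul_exp_norm_le hlam hS fun j =>
    (ENNReal.ofReal_le_iff_le_toReal hy.ne).1 (hZle y j)
  exact ⟨b, hb, (ENNReal.ofReal_le_iff_le_toReal hy.ne).2 hexp⟩

lemma SeriesAssumption.ae_mem_U0 (hψ : SeriesAssumption ψ) : ∀ᵐ y ∂gaussian, y ∈ U0 ψ := by
  obtain ⟨_, _, hae⟩ := hψ.exists_majorant
  filter_upwards [hae] with y hy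
  obtain ⟨b, hb, -⟩ := hy
  exact ⟨b, isLogCoeff_of_tendsto hb⟩

lemma SeriesAssumption.isGaussianCoeff_logCoeff (hψ : SeriesAssumption ψ) :
    IsGaussianCoeff ψ (logCoeff ψ) := by
  obtain ⟨Z, hZint, hae⟩ := hψ.exists_majorant
  have hmeas : AEStronglyMeasurable (logCoeff ψ) gaussian := by
    refine aestronglyMeasurable_of_tendsto_ae atTop
      (f := fun n y => ∑ j ∈ Finset.range n, y j • ψ j) (fun n => Continuous.aestronglyMeasurable
        (continuous_finsetSum _ fun j _ => (continuous_apply j).smul continuous_const)) ?_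
    filter_upwards [hae] with y hy
    obtain ⟨b, hb, -⟩ := hy
    rwa [logCoeff_eq (isLogCoeff_of_tendsto hb)]
  refine ⟨hmeas, ⟨?_, ?_⟩, ?_⟩
  · exact (Real.continuous_exp.comp_aestronglyMeasurable hmeas.norm).pow 2
  · refine (lintegral_mono_ae ?_).trans_lt hZint.lt_top
    filter_upwards [hae] with y hy
    obtain ⟨b, hb, hle⟩ := hy
    rwa [logCoeff_eq (isLogCoeff_of_tendsto hb), Real.enorm_eq_ofReal (by positivity)]
  · filter_upwards [hae] with y hy j t
    obtain ⟨b, hb, -⟩ := hy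
    have hlog := isLogCoeff_of_tendsto hb
    rw [logCoeff_eq hlog, logCoeff_eq (hlog.update j t)]

end LogCoeff

section Solution

lemma ae_sum_le_of_essSup_tsum_le {Ω : Type*} [MeasurableSpace Ω] {m : Measure Ω}
    {g : ℕ → Ω → ℝ} (hg : ∀ j x, 0 ≤ g j x) {κ : ℝ} (hκ0 : 0 ≤ κ)
    (h : essSup (fun x => ∑' j, ENNReal.ofReal (g j x)) m ≤ ENNReal.ofReal κ) (n : ℕ) :
    ∀ᵐ x ∂m, ∑ j ∈ Finset.range n, g j x ≤ κ := by
  filter_upwards [ENNReal.ae_le_essSup (μ := m) fun x => ∑' j, ENNReal.ofReal (g j x)] with x hx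
  rw [← ENNReal.ofReal_le_ofReal_iff hκ0, ENNReal.ofReal_sum_of_nonneg fun j _ => hg j x]
  exact (ENNReal.sum_le_tsum _).trans (hx.trans h)

variable {d : ℕ} {D : Set (Space d)} {ψ : ℕ → LInf D} {f : H10 D →L[ℝ] ℝ}

lemma isWeakSolution_iff_eq_solution (hD : HasPoincare D) {y : ℕ → ℝ} {b : LInf D}
    (hb : IsLogCoeff ψ y b) (w : H10 D) : IsWeakSolution b f w ↔ w = solution ψ f y := by
  obtain ⟨u, hu, huniq⟩ := existsUnique_isWeakSolution hD b f
  have hex : ∃ u : H10 D, ∃ b : LInf D, IsLogCoeff ψ y b ∧ IsWeakSolution b f u := ⟨u, b, hb, hu⟩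
  have hsol : IsWeakSolution b f (solution ψ f y) := by
    rw [solution, dif_pos hex]
    obtain ⟨b', hb', hw'⟩ := hex.choose_spec
    rwa [hb'.unique hb] at hw'
  exact ⟨fun hw => (huniq w hw).trans (huniq _ hsol).symm, fun hw => hw ▸ hsol⟩

variable (D) in
/-- The holomorphic extension of `b ↦ u(b)` to complex coefficients; `u₀` is the solution for the
coefficient `1`, which represents the functional `f`. -/
abbrev complexSolution (u₀ : H10 D) :
    Lp ℂ ∞ (volume.restrict D) → gradSpace D :=
  solveOp (gradSpace D) ⟨cgrad D u₀, cgrad_mem_gradSpace u₀⟩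

lemma ae_cgrad_solution (hD : HasPoincare D) (hψ : SeriesAssumption ψ) {u₀ : H10 D}
    (h₀ : IsWeakSolution 0 f u₀) :
    ∀ᵐ y ∂gaussian, cgrad D (solution ψ f y) =
      (gradSpace D).subtypeL (complexSolution D u₀ (toC (logCoeff ψ y))) := by
  filter_upwards [hψ.ae_mem_U0] with y hy
  obtain ⟨b, hb⟩ := hy
  rw [logCoeff_eq hb]
  exact cgrad_eq_solveOp h₀ ((isWeakSolution_iff_eq_solution hD hb _).2 rfl)

lemma memLp_complexSolution (hψ : SeriesAssumption ψ) (u₀ : H10 D) :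
    MemLp (fun y => complexSolution D u₀ (toC (logCoeff ψ y))) 2 gaussian :=
  hψ.isGaussianCoeff_logCoeff.memLp_comp (isStripHolomorphic_solveOp _ _)

lemma memLp_of_memLp_cgrad (hD : HasPoincare D) {Ω : Type*} [MeasurableSpace Ω] {m : Measure Ω}
    {w : Ω → H10 D} {p : ℝ≥0∞} (hw : MemLp (fun y => cgrad D (w y)) p m) : MemLp w p m := by
  obtain ⟨C, hC0, hC⟩ := hD
  simp only [← norm_cgrad] at hC
  have hemb : IsEmbedding (cgrad D) :=
    ((cgrad D).antilipschitz_of_bound (K := ⟨C, hC0.le⟩) hC).isEmbedding (cgrad D).continuous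
  exact hw.of_le_mul (hemb.aestronglyMeasurable_comp_iff.1 hw.aestronglyMeasurable)
    (ae_of_all _ fun y => hC _)

lemma memLp_solution (hD : HasPoincare D) (hψ : SeriesAssumption ψ) :
    MemLp (solution ψ f) 2 gaussian := by
  obtain ⟨u₀, h₀, -⟩ := existsUnique_isWeakSolution hD 0 f
  exact memLp_of_memLp_cgrad hD (((gradSpace D).subtypeL.restrictScalars ℝ).comp_memLp'
    (memLp_complexSolution hψ u₀) |>.ae_eq ((ae_cgrad_solution hD hψ h₀).mono fun _ => Eq.symm))

lemma normV_hermiteCoeff (hD : HasPoincare D) (hψ : SeriesAssumption ψ) {u₀ : H10 D}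
    (h₀ : IsWeakSolution 0 f u₀) (ν : ℕ →₀ ℕ) :
    normV (hermiteCoeff (solution ψ f) ν) =
      ‖hermiteCoeff (fun y => complexSolution D u₀ (toC (logCoeff ψ y))) ν‖ := by
  have hae : ∀ᵐ y ∂gaussian, hermiteMulti ν y • cgrad D (solution ψ f y) = hermiteMulti ν y •
      (gradSpace D).subtypeL.restrictScalars ℝ (complexSolution D u₀ (toC (logCoeff ψ y))) :=
    (ae_cgrad_solution hD hψ h₀).mono fun y hy => congrArg _ hy
  calc normV (hermiteCoeff (solution ψ f) ν)
      = ‖hermiteCoeff (fun y => cgrad D (solution ψ f y)) ν‖ := by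
        rw [← norm_cgrad, hermiteCoeff_comp _ (memLp_solution hD hψ)]
    _ = ‖(gradSpace D).subtypeL.restrictScalars ℝ
          (hermiteCoeff (fun y => complexSolution D u₀ (toC (logCoeff ψ y))) ν)‖ := by
        rw [← hermiteCoeff_comp _ (memLp_complexSolution hψ u₀)]
        exact congrArg norm (integral_congr_ae hae)
    _ = _ := rfl

lemma summable_beta_mul_normV_sq (hD : HasPoincare D) (hψ : SeriesAssumption ψ) {ϱ : ℕ → ℝ}
    {r : ℕ} {ρ : (ℕ →₀ ℕ) → ℕ → ℝ} (hρ : ∀ ν, (∀ j, ν j ≤ r) → ∀ j, 0 ≤ ρ ν j)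
    (hsupp : ∀ ν, (∀ j, ν j ≤ r) → ∀ j, ν j ≠ 0 → ρ ν j ≠ 0) {κ : ℝ} (hκ : κ < Real.pi / 2)
    (hρκ : ∀ ν, (∀ j, ν j ≤ r) → essSup (fun x => ∑' j, ENNReal.ofReal (ρ ν j * |ψ j x|))
      (volume.restrict D) ≤ ENNReal.ofReal κ)
    (hsum : Summable fun ν : {ν : ℕ →₀ ℕ // ∀ j, ν j ≤ r} =>
      multiFactorial ν.1 * multiPow ϱ (2 • ν.1) / multiPow (ρ ν.1) (2 • ν.1)) :
    Summable fun ν => beta r ϱ ν * normV (hermiteCoeff (solution ψ f) ν) ^ 2 := by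
  obtain ⟨u₀, h₀, -⟩ := existsUnique_isWeakSolution hD 0 f
  have hG : IsStripHolomorphic (complexSolution D u₀) := isStripHolomorphic_solveOp _ _
  have hκ' : max κ 0 < Real.pi / 2 := max_lt hκ Real.pi_div_two_pos
  obtain ⟨C, hC0, hC⟩ := hG.growth _ hκ'
  simp only [normV_hermiteCoeff hD hψ h₀]
  set Q := (C * Real.exp (max κ 0)) ^ 2 * ∫ y, Real.exp ‖logCoeff ψ y‖ ^ 2 ∂gaussian
  refine summable_beta_mul (B := fun μ => multiFactorial μ / multiPow (ρ μ) (2 • μ) * Q)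
    (fun ν => sq_nonneg _) (fun μ hμ T => ?_) ((hsum.mul_right Q).congr fun μ => by ring)
  exact hψ.isGaussianCoeff_logCoeff.sum_multiChoose_mul_le hG (le_max_right κ 0) hκ' hC0 hC μ
    (hρ μ hμ) (hsupp μ hμ) (ae_sum_le_of_essSup_tsum_le
      (fun j x => mul_nonneg (hρ μ hμ j) (abs_nonneg _)) (le_max_right κ 0)
      ((hρκ μ hμ).trans (ENNReal.ofReal_le_ofReal (le_max_left κ 0)))) T

end Solution

end LogGaussian

end

open LogGaussian in
theorem theorem3p16_general {d : ℕ} (D : Set (Space d)) (hD : HasPoincare D)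
    (f : H10 D →L[ℝ] ℝ) (ψ : ℕ → LInf D) (hψ : SeriesAssumption ψ) (q : ℝ) (hq : 0 < q)
    (ϱ : ℕ → ℝ) (hϱ : ∀ j, 0 < ϱ j) (hϱq : Memℓp (fun j => (ϱ j)⁻¹) (ENNReal.ofReal q))
    (r : ℕ) (hr : 2 / q < (r : ℝ))
    (ρ : (ℕ →₀ ℕ) → ℕ → ℝ) (hρ : ∀ ν, (∀ j, ν j ≤ r) → ∀ j, 0 ≤ ρ ν j)
    (hsupp : ∀ ν : ℕ →₀ ℕ, (∀ j, ν j ≤ r) → ∀ j, ν j ≠ 0 → ρ ν j ≠ 0)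
    (κ : ℝ) (hκ : κ < Real.pi / 2)
    (hρκ : ∀ ν : ℕ →₀ ℕ, (∀ j, ν j ≤ r) →
      essSup (fun x => ∑' j, ENNReal.ofReal (ρ ν j * |ψ j x|)) (volume.restrict D)
        ≤ ENNReal.ofReal κ)
    (hsum : Summable fun ν : {ν : ℕ →₀ ℕ // ∀ j, ν j ≤ r} =>
      multiFactorial ν.1 * multiPow ϱ (2 • ν.1) / multiPow (ρ ν.1) (2 • ν.1)) :
    (∀ᵐ y ∂gaussian, y ∈ U0 ψ) ∧
    (∀ y b, IsLogCoeff ψ y b → ∀ w : H10 D, IsWeakSolution b f w ↔ w = solution ψ f y) ∧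
    MemLp (solution ψ f) 2 gaussian ∧
    (Summable fun ν : ℕ →₀ ℕ => beta r ϱ ν * normV (hermiteCoeff (solution ψ f) ν) ^ 2) ∧
    Memℓp (fun ν : ℕ →₀ ℕ => beta r ϱ ν ^ (-(1 / 2) : ℝ)) (ENNReal.ofReal q) ∧
    ∀ p : ℝ, 1 / p = 1 / q + 1 / 2 →
      Memℓp (fun ν : ℕ →₀ ℕ => normV (hermiteCoeff (solution ψ f) ν)) (ENNReal.ofReal p) := by
  have hbeta := summable_beta_mul_normV_sq (f := f) hD hψ hρ hsupp hκ hρκ hsum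
  have hell := memℓp_beta hq hϱ hϱq hr
  exact ⟨hψ.ae_mem_U0, fun y b hb => isWeakSolution_iff_eq_solution hD hb,
    memLp_solution hD hψ, hbeta, hell, fun p hp => memℓp_of_summable_mul_sq hq hp (beta_pos r ϱ)
      (fun ν => norm_nonneg _) hbeta hell⟩

theorem theorem3p16 {d : ℕ} (hd : 1 ≤ d) (D : Set (LogGaussian.Space d))
    (hD : IsOpen D) (hDb : Bornology.IsBounded D)
    (f : LogGaussian.H10 D →L[ℝ] ℝ)
    (ψ : ℕ → LogGaussian.LInf D) (hψ : LogGaussian.SeriesAssumption ψ)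
    (q : ℝ) (hq : 0 < q)
    (ϱ : ℕ → ℝ) (hϱ : ∀ j, 0 < ϱ j) (hϱq : Memℓp (fun j => (ϱ j)⁻¹) (ENNReal.ofReal q))
    (r : ℕ) (hr : 2 / q < (r : ℝ))
    (ρ : (ℕ →₀ ℕ) → ℕ → ℝ) (hρ : ∀ ν j, 0 ≤ ρ ν j)
    (hsupp : ∀ (ν : ℕ →₀ ℕ) (j : ℕ), ν j ≠ 0 → ρ ν j ≠ 0)
    (κ : ℝ) (hκ : κ < Real.pi / 2)
    (hρκ : ∀ ν, essSup (fun x => ∑' j, ENNReal.ofReal (ρ ν j * |ψ j x|)) (volume.restrict D)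
      ≤ ENNReal.ofReal κ)
    (hsum : Summable fun ν : {ν : ℕ →₀ ℕ // ∀ j, ν j ≤ r} =>
      LogGaussian.multiFactorial ν.1 * LogGaussian.multiPow ϱ (2 • ν.1)
        / LogGaussian.multiPow (ρ ν.1) (2 • ν.1)) :
    -- the problem is well posed for almost every parameter, and `u` lies in `L²(U, V; γ)`
    (∀ᵐ y ∂LogGaussian.gaussian, y ∈ LogGaussian.U0 ψ) ∧
    (∀ y b, LogGaussian.IsLogCoeff ψ y b → ∀ w : LogGaussian.H10 D,
      LogGaussian.IsWeakSolution b f w ↔ w = LogGaussian.solution ψ f y) ∧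
    MemLp (LogGaussian.solution ψ f) 2 LogGaussian.gaussian ∧
    -- weighted square summability
    (Summable fun ν : ℕ →₀ ℕ => LogGaussian.beta r ϱ ν *
      LogGaussian.normV (LogGaussian.hermiteCoeff (LogGaussian.solution ψ f) ν) ^ 2) ∧
    Memℓp (fun ν : ℕ →₀ ℕ => LogGaussian.beta r ϱ ν ^ (-(1 / 2) : ℝ)) (ENNReal.ofReal q) ∧
    -- summability of the coefficients
    ∀ p : ℝ, 1 / p = 1 / q + 1 / 2 →
      Memℓp (fun ν : ℕ →₀ ℕ =>
        LogGaussian.normV (LogGaussian.hermiteCoeff (LogGaussian.solution ψ f) ν))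
        (ENNReal.ofReal p) := by
  exact theorem3p16_general D (LogGaussian.hasPoincare_of_isBounded hd hDb) f ψ hψ q hq ϱ hϱ hϱq
    r hr ρ (fun ν _ => hρ ν) (fun ν _ => hsupp ν) κ hκ (fun ν _ => hρκ ν) hsum
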